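/- Let $\Theta\subset\mathbb R^d$ be compact, let $f_1,\dots,f_n:\Theta\to\mathbb R$ be measurable, and let $f=\sum_{i=1}^n f_i$ be bounded on $\Theta$. Let $\mathcal I_0,\mathcal I_1,\dots,\mathcal I_T$ be a partition of $\{1,\dots,n\}$ (empty blocks allowed), and put $G_t=\exp(-\sum_{i\in\mathcal I_t}f_i)$; suppose $G_1,\dots,G_T$ are bounded. Let the prior $\pi_0$ be the probability measure on $\Theta$ with Lebesgue density proportional to $\exp(-\sum_{i\in\mathcal I_0}f_i)$, assumed integrable (the uniform distribution if $\mathcal I_0=\emptyset$). Let $\pi_t(\theta)=\pi_{t-1}(\theta)G_t(\theta)/\int_\Theta G_t\,\mathrm d\pi_{t-1}$ be the density of $\pi_t$, $1\le t\le T$, so that $\pi_T(\theta)\propto e^{-f(\theta)}$. Suppose that $\pi_T(\theta)$ is Lipschitz on $\Theta$ and that $f$ has a global minimizer in the interior of $\Theta$. For each $N\ge1$ let $\kappa=\kappa_N$ be a Markov kernel on $\Theta$ such that $\sup_{\theta'\in\Theta}\int_\Theta|\varphi(\theta)-\varphi(\theta')|\,\kappa(\mathrm d\theta|\theta')\le c_\kappa\|\varphi\|_\infty/\sqrt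 N$ for all bounded measurable $\varphi$, with $c_\kappa$ independent of $N$. For each $N\geq 1$ run the following sampler, all runs being defined on a common probability space: draw $\theta_0^{(1)},\dots,\theta_0^{(N)}$ i.i.d. from $\pi_0$; for $t=1,\dots,T$, given the past, draw independently $\hat\theta_t^{(i)}\sim\kappa(\cdot|\theta_{t-1}^{(i)})$, $i=1,\dots,N$, and then draw $\theta_t^{(1)},\dots,\theta_t^{(N)}$ i.i.d. from $\sum_{j=1}^N w_t^{(j)}\delta_{\hat\theta_t^{(j)}}$, where $w_t^{(j)}=G_t(\hat\theta_t^{(j)})/\sum_{l=1}^N G_t(\hat\theta_t^{(l)})$. Let $\mathsf k:\mathbb R^d\to[0,\infty)$ be a bounded probability density with zero mean and finite second moment, whose partial derivatives $\mathsf D^\alpha\mathsf k$ exist and are continuous and bounded for all $\alpha\in\{0,1\}^d$. Put $h=\lfloor N^{1/(2(d+1))}\rfloor^{-1}$, $\mathsf k_h(x)=h^{-d}\mathsf k(h^{-1}x)$ and $\mathsf p_T^N(\theta)=\frac1N\sum_{i=1}^N\mathsf k_h(\theta-\theta_T^{(i)})$. Choose any $\theta^\star\in\arg\min_{\theta\in\Theta}f(\theta)$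 and, for each $N$, any random variable $\theta_T^{\star,N}$ that almost surely is a particle $\theta_T^{(i)}$ with the largest value $\mathsf p_T^N(\theta_T^{(i)})$, $i\in\{1,\dots,N\}$. Then for every $\varepsilon\in(0,1)$ there is an integrable random variable $\tilde W=\tilde W_{T,d,\varepsilon}$, independent of $N$ (that is, the same for all $N$), such that almost surely $$0\le f(\theta_T^{\star,N})-f(\theta^\star)\le\frac{\tilde W}{N^{\frac{1-\varepsilon}{2(d+1)}}}\qquad\text{for all }N\ge1,$$ and, with the finite constant $C_{T,d,\varepsilon}=\mathbb E[\tilde W]$, for all $N\ge1$, $$0\le\mathbb E[f(\theta_T^{\star,N})]-f(\theta^\star)\le\frac{C_{T,d,\varepsilon}}{N^{\frac{1-\varepsilon}{2(d+1)}}}.$$ -/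

import Mathlib

open MeasureTheory ProbabilityTheory

noncomputable section

namespace SMCOpt

/-- The cost function `f = ∑ᵢ fᵢ` on the search space `Θ`. -/
def totalCost {S : Type*} {n : ℕ} (f : Fin n → S → ℝ) (θ : S) : ℝ :=
  ∑ i, f i θ

/-- The potential `exp (-∑_{i ∈ J} fᵢ)` of a mini-batch `J` of component functions. -/
def potential {S : Type*} {n : ℕ} (f : Fin n → S → ℝ) (J : Finset (Fin n)) (θ : S) : ℝ :=
  Real.exp (-∑ i ∈ J, f i θ)

/-- Lebesgue measure on a subset `Θ` of `ℝᵈ`. -/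
def lebesgueOn {d : ℕ} (Θ : Set (EuclideanSpace ℝ (Fin d))) : Measure Θ :=
  Measure.comap Subtype.val volume

/-- The probability density functions of the target sequence `π₀, π₁, …` with respect to the
reference measure `μ` (below: Lebesgue measure on `Θ`). The prior density is proportional to
the potential of the batch `I 0` (so that the prior is uniform if `I 0 = ∅`), and
`πₜ(θ) = πₜ₋₁(θ) Gₜ(θ) / ∫ Gₜ dπₜ₋₁`, with `Gₜ` the potential of the batch `I t`, for `t ≥ 1`. -/
def targetDensity {S : Type*} [MeasurableSpace S] (μ : Measure S) {n : ℕ} (f : Fin n → S → ℝ)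
    (I : ℕ → Finset (Fin n)) : ℕ → S → ℝ
  | 0 => fun θ => potential f (I 0) θ / ∫ θ', potential f (I 0) θ' ∂μ
  | t + 1 => fun θ => targetDensity μ f I t θ * potential f (I (t + 1)) θ /
      ∫ θ', potential f (I (t + 1)) θ' * targetDensity μ f I t θ' ∂μ

/-- The prior probability measure `π₀`. -/
def prior {S : Type*} [MeasurableSpace S] (μ : Measure S) {n : ℕ} (f : Fin n → S → ℝ)
    (I : ℕ → Finset (Fin n)) : Measure S :=
  μ.withDensity fun θ => ENNReal.ofReal (targetDensity μ f I 0 θ)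

/-- The condition on the family of jittering kernels `κ N` (one for every number `N` of particles):
`sup_{θ'} ∫ |φ(θ) - φ(θ')| κ(dθ | θ') ≤ c ‖φ‖_∞ / √N` for all bounded measurable `φ`, with `c`
independent of `N`. -/
def IsJittering {S : Type*} [MeasurableSpace S] (κ : ℕ → Kernel S S) : Prop :=
  ∃ c : ℝ, ∀ N : ℕ, 1 ≤ N → ∀ φ : S → ℝ, Measurable φ → ∀ B : ℝ, (∀ θ, |φ θ| ≤ B) →
    ∀ θ' : S, ∫ θ, |φ θ - φ θ'| ∂(κ N θ') ≤ c * B / √(N : ℝ)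

/-- The weighted empirical measure `∑ⱼ wⱼ δ_{yⱼ}`, with weights `wⱼ = G(yⱼ) / ∑ₗ G(yₗ)`. -/
def weightedEmpirical {S : Type*} [MeasurableSpace S] {N : ℕ} (G : S → ℝ) (y : Fin N → S) :
    Measure S :=
  ∑ j, ENNReal.ofReal (G (y j) / ∑ l, G (y l)) • Measure.dirac (y j)

/-- The σ-algebra generated by all particles `θ_s^{(i)}` with `0 ≤ s ≤ t` and all jittered
particles `θ̂_s^{(i)}` with `1 ≤ s ≤ t`. -/
abbrev history {Ω S : Type*} [MeasurableSpace S] {N : ℕ} (X Y : ℕ → Fin N → Ω → S) (t : ℕ) :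
    MeasurableSpace Ω :=
  (⨆ (s : ℕ) (_ : s ≤ t) (i : Fin N), MeasurableSpace.comap (X s i) inferInstance) ⊔
    (⨆ (s : ℕ) (_ : 1 ≤ s ∧ s ≤ t) (i : Fin N), MeasurableSpace.comap (Y s i) inferInstance)

/-- `X t i` (for `0 ≤ t ≤ T`) and `Y t i` (for `1 ≤ t ≤ T`) are the particles `θ_t^{(i)}` and the
jittered particles `θ̂_t^{(i)}` of a run of the sampler with `N` particles over `T` iterations, with
initial distribution `π₀`, jittering kernel `κ` and potentials `G 1, …, G T`. -/
structure IsSampler {Ω S : Type*} [MeasurableSpace Ω] [MeasurableSpace S] (P : Measure Ω)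
    (π₀ : Measure S) (κ : Kernel S S) (G : ℕ → S → ℝ) (T N : ℕ)
    (X Y : ℕ → Fin N → Ω → S) : Prop where
  measurable_particle : ∀ t ≤ T, ∀ i, Measurable (X t i)
  measurable_jittered : ∀ t, 1 ≤ t → t ≤ T → ∀ i, Measurable (Y t i)
  /-- The initial particles are i.i.d. samples from `π₀`. -/
  indep_init : iIndepFun (X 0) P
  law_init : ∀ i, P.map (X 0 i) = π₀
  /-- Given the history up to time `t`, the jittered particles `Y (t + 1) i` are independent, the
  `i`-th one with law `κ(· | X t i)`. -/
  jitter : ∀ t < T, ∀ A : Fin N → Set S, (∀ i, MeasurableSet (A i)) →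
    P[(⋂ i, Y (t + 1) i ⁻¹' A i).indicator (fun _ => (1 : ℝ)) | history X Y t]
      =ᵐ[P] fun ω => ∏ i, (κ (X t i ω)).real (A i)
  /-- Given the history up to time `t` and the jittered particles `Y (t + 1) i`, the particles
  `X (t + 1) i` are i.i.d. samples from the weighted empirical measure. -/
  resample : ∀ t < T, ∀ A : Fin N → Set S, (∀ i, MeasurableSet (A i)) →
    P[(⋂ i, X (t + 1) i ⁻¹' A i).indicator (fun _ => (1 : ℝ)) |
        history X Y t ⊔ ⨆ i, MeasurableSpace.comap (Y (t + 1) i) inferInstance]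
      =ᵐ[P] fun ω => ∏ i,
        (weightedEmpirical (G (t + 1)) (fun j => Y (t + 1) j ω)).real (A i)

/-- The mixed partial derivative `∂_{i₁} ∂_{i₂} ⋯ ∂_{iₘ} k` for the list `[i₁, …, iₘ]`. -/
def mixedPartial {d : ℕ} (k : EuclideanSpace ℝ (Fin d) → ℝ) :
    List (Fin d) → EuclideanSpace ℝ (Fin d) → ℝ
  | [] => k
  | i :: l => fun x => lineDeriv ℝ (mixedPartial k l) x (EuclideanSpace.single i 1)

/-- The assumptions on the smoothing kernel `k` of the density estimator: a bounded, zero-mean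
probability density on `ℝᵈ` with finite second moment whose partial derivatives `D^α k`,
`α ∈ {0,1}ᵈ`, exist and are continuous and bounded. The multi-indices `α ∈ {0,1}ᵈ` are given by the
strictly increasing lists of coordinates. -/
structure IsSmoothingKernel {d : ℕ} (k : EuclideanSpace ℝ (Fin d) → ℝ) : Prop where
  nonneg : ∀ x, 0 ≤ k x
  integrable : Integrable k
  integral_eq_one : ∫ x, k x = 1
  integrable_sq : Integrable fun x => ‖x‖ ^ 2 * k x
  mean_zero : ∫ x, k x • x = 0
  differentiable : ∀ (i : Fin d) (l : List (Fin d)), (i :: l).Pairwise (· < ·) →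
    ∀ x, LineDifferentiableAt ℝ (mixedPartial k l) x (EuclideanSpace.single i 1)
  continuous : ∀ l : List (Fin d), l.Pairwise (· < ·) → Continuous (mixedPartial k l)
  bounded : ∀ l : List (Fin d), l.Pairwise (· < ·) → ∃ B : ℝ, ∀ x, |mixedPartial k l x| ≤ B

/-- The bandwidth `h = ⌊N^{1/(2(d+1))}⌋⁻¹`. -/
def bandwidth (d N : ℕ) : ℝ :=
  (⌊(N : ℝ) ^ (1 / (2 * ((d : ℝ) + 1)))⌋₊ : ℝ)⁻¹

/-- The scaled kernel `k_h(x) = h^{-d} k(h⁻¹ x)`. -/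
def scaledKernel {d : ℕ} (k : EuclideanSpace ℝ (Fin d) → ℝ) (h : ℝ)
    (x : EuclideanSpace ℝ (Fin d)) : ℝ :=
  (h ^ d)⁻¹ * k (h⁻¹ • x)

/-- The kernel density estimator `p^N(θ) = N⁻¹ ∑ᵢ k_h(θ - xᵢ)` of the particles `x`, with bandwidth
`h = ⌊N^{1/(2(d+1))}⌋⁻¹`. -/
def kde {d N : ℕ} {Θ : Set (EuclideanSpace ℝ (Fin d))} (k : EuclideanSpace ℝ (Fin d) → ℝ)
    (x : Fin N → Θ) (θ : Θ) : ℝ :=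
  (N : ℝ)⁻¹ * ∑ i, scaledKernel k (bandwidth d N) ((θ : EuclideanSpace ℝ (Fin d)) - x i)

end SMCOpt

end

open SMCOpt

/-! The density of `π_T` is `q = c * exp (-f)`. Since `f` is bounded, `q ≥ q₀ > 0`, and `1 + x ≤ exp
x` bounds the excess of `f` over its minimum by `(q θ₀ - q θ) / q₀`, where `θ₀` is an interior
minimizer. It remains to show that the best particle has nearly maximal density.

Concentration (`ExpConcentrates`): averages of a test function bounded by `B` over the `N` particles
deviate from their target integral by `u * B` with probability at most `b * exp (-a N u²)`, with
`a`, `b` independent of `N` and of the function. This holds for i.i.d. samples by Hoeffding and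
passes from `t` to `t + 1`: jittering adds conditionally independent noise and a bias `O(1 / √N)`,
and resampling adds conditionally independent noise around a ratio of two concentrated averages.

Density estimation (`exists_density_gap_tail`): with `s = N ^ (1 / (2 (d + 1)))`, `h` of order `1 /
s` and `w = s ^ ε`, the function `k_h (z - ·)` is `O(h⁻ᵈ)`. A relative deviation `w / s ^ (d + 1)`
therefore costs an error `O(w / s)` and has probability `O(exp (-a w²))`. A net of `O(N ^ d)` points
makes this uniform in `z`. Smoothing has bias `O(h)`: from above everywhere on `Θ`, from below away
from the boundary. The lower bound is needed only at some particle within `O(h)` of `θ₀`, which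
exists with high probability because the mass `≳ hᵈ` of that ball exceeds the fluctuations. The
maximizing particle has at least the same estimate, and there the upper bound suffices, even near
the boundary (`density_gap_le`).

The failure probabilities remain summable after multiplication by the rate, so the rare failures can
be absorbed into one integrable variable (`exists_integrable_rate`). -/

/-! ### Hoeffding inequalities, unconditional and conditional -/

/-- Two-sided Hoeffding inequality for the average of independent bounded random variables. -/
theorem hoeffding_average {Ω : Type*} [MeasurableSpace Ω] {P : Measure Ω} {N : ℕ} (hN : 1 ≤ N)
    {ξ : Fin N → Ω → ℝ} (hind : iIndepFun ξ P) (hm : ∀ i, AEMeasurable (ξ i) P)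
    {B : ℝ} (hB : 0 < B) (hb : ∀ i ω, |ξ i ω| ≤ B) {u : ℝ} (hu : 0 ≤ u) :
    P.real {ω | u * B ≤ |(N : ℝ)⁻¹ * ∑ i, ξ i ω - (N : ℝ)⁻¹ * ∑ i, ∫ ω', ξ i ω' ∂P|}
      ≤ 2 * Real.exp (-(N * u ^ 2 / 2)) := by
  have : IsProbabilityMeasure P := hind.isProbabilityMeasure
  have hN0 : (0 : ℝ) < N := by exact_mod_cast hN
  have hsub : ∀ i, HasSubgaussianMGF (fun ω => ξ i ω - ∫ ω', ξ i ω' ∂P)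
      ((‖B - (-B)‖₊ / 2) ^ 2) P := fun i =>
    hasSubgaussianMGF_of_mem_Icc (hm i) (ae_of_all _ fun ω => abs_le.1 (hb i ω))
  -- Hoeffding's lemma on `[-B, B]` gives the squared half-length of the interval as variance proxy.
  have hc : (((‖B - (-B)‖₊ / 2) ^ 2 : NNReal) : ℝ) = B ^ 2 := by
    have : ‖B - (-B)‖ = 2 * B := by
      rw [Real.norm_eq_abs, abs_of_nonneg] <;> linarith
    push_cast
    rw [this]; ring
  have hNu : 0 ≤ N * (u * B) := by positivity
  have hind1 : iIndepFun (fun i ω => ξ i ω - ∫ ω', ξ i ω' ∂P) P :=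
    hind.comp (fun i x => x - ∫ ω', ξ i ω' ∂P) (fun i => measurable_id.sub_const _)
  have hind2 : iIndepFun (fun i ω => -(ξ i ω - ∫ ω', ξ i ω' ∂P)) P :=
    hind1.comp (fun i x => -x) (fun i => measurable_neg)
  have h1 := HasSubgaussianMGF.measure_sum_ge_le_of_iIndepFun hind1 (s := Finset.univ)
    (fun i _ => hsub i) hNu
  have h2 := HasSubgaussianMGF.measure_sum_ge_le_of_iIndepFun hind2 (s := Finset.univ)
    (fun i _ => (hsub i).neg) hNu
  have he : -(N * (u * B)) ^ 2 / (2 * ((∑ i : Fin N, (‖B - (-B)‖₊ / 2) ^ 2 : NNReal) : ℝ))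
      = -(N * u ^ 2 / 2) := by
    rw [NNReal.coe_sum, hc]; simp only [Finset.sum_const, Finset.card_univ, Fintype.card_fin, nsmul_eq_mul]
    field_simp
  rw [he] at h1 h2
  refine (measureReal_mono (s₂ := {ω | N * (u * B) ≤ ∑ i, (ξ i ω - ∫ ω', ξ i ω' ∂P)} ∪
    {ω | N * (u * B) ≤ ∑ i, -(ξ i ω - ∫ ω', ξ i ω' ∂P)}) ?_).trans
    ((measureReal_union_le _ _).trans ?_)
  · intro ω hω
    have hω' : u * B ≤ |(N : ℝ)⁻¹ * ∑ i, ξ i ω - (N : ℝ)⁻¹ * ∑ i, ∫ ω', ξ i ω' ∂P| := hω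
    rw [← mul_sub, ← Finset.sum_sub_distrib, abs_mul, abs_of_pos (inv_pos.2 hN0)] at hω'
    have h3 : N * (u * B) ≤ |∑ i, (ξ i ω - ∫ ω', ξ i ω' ∂P)| := by
      have := mul_le_mul_of_nonneg_left hω' hN0.le
      rwa [← mul_assoc (N : ℝ) (N : ℝ)⁻¹, mul_inv_cancel₀ hN0.ne', one_mul] at this
    rcases le_abs.1 h3 with h | h
    · exact Or.inl h
    · right
      show N * (u * B) ≤ ∑ i, -(ξ i ω - ∫ ω', ξ i ω' ∂P)
      rwa [Finset.sum_neg_distrib]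
  · linarith

/-- The product kernel `z ↦ ⨂ᵢ K i z`. -/
noncomputable def piKernel {E S : Type*} [MeasurableSpace E] [MeasurableSpace S] {N : ℕ}
    (K : Fin N → Kernel E S) [∀ i, IsMarkovKernel (K i)] : Kernel E (Fin N → S) where
  toFun z := Measure.pi fun i => K i z
  measurable' := by
    refine Measurable.measure_of_isPiSystem_of_isProbabilityMeasure generateFrom_pi.symm
      isPiSystem_pi ?_
    rintro _ ⟨A, hA, rfl⟩
    simp only [Set.mem_pi, Set.mem_univ, forall_const, Set.mem_ofPred_eq] at hA
    simp_rw [Measure.pi_pi]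
    exact Finset.measurable_prod _ fun i _ => (K i).measurable_coe (hA i)

instance {E S : Type*} [MeasurableSpace E] [MeasurableSpace S] {N : ℕ}
    (K : Fin N → Kernel E S) [∀ i, IsMarkovKernel (K i)] : IsMarkovKernel (piKernel K) :=
  ⟨fun z => inferInstanceAs (IsProbabilityMeasure (Measure.pi fun i => K i z))⟩

/-- If the conditional law of `Y` given `m` is a product that depends on an `m`-measurable `Z`,
then `(Z, Y)` has the law obtained by composing the law of `Z` with the product kernel. -/
theorem map_pair_eq_compProd {Ω E S : Type*} {m mΩ : MeasurableSpace Ω} [MeasurableSpace E]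
    [MeasurableSpace S] {P : Measure Ω} [IsProbabilityMeasure P] (hm : m ≤ mΩ) {N : ℕ}
    (K : Fin N → Kernel E S) [∀ i, IsMarkovKernel (K i)] {Z : Ω → E} (hZ : Measurable[m] Z)
    {Y : Fin N → Ω → S} (hY : ∀ i, Measurable (Y i))
    (hcond : ∀ A : Fin N → Set S, (∀ i, MeasurableSet (A i)) →
      P[(⋂ i, Y i ⁻¹' A i).indicator (fun _ => (1 : ℝ)) | m]
        =ᵐ[P] fun ω => ∏ i, (K i (Z ω)).real (A i)) :
    P.map (fun ω => (Z ω, fun i => Y i ω)) = (P.map Z) ⊗ₘ piKernel K := by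
  have hZ' : Measurable Z := hZ.mono hm le_rfl
  have hY' : Measurable fun ω i => Y i ω := measurable_pi_lambda _ hY
  have : IsProbabilityMeasure (P.map Z) := Measure.isProbabilityMeasure_map hZ'.aemeasurable
  have : IsProbabilityMeasure (P.map (fun ω => (Z ω, fun i => Y i ω))) :=
    Measure.isProbabilityMeasure_map (hZ'.prodMk hY').aemeasurable
  -- Both sides are probability measures, so agreement on the π-system of sets `s ×ˢ ∏ A i`
  -- suffices. There the identity is the conditional law integrated over the event `Z ∈ s`.
  refine ext_of_generate_finite
    (Set.image2 (· ×ˢ ·) {s : Set E | MeasurableSet s}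
      (Set.pi Set.univ '' Set.pi Set.univ fun _ : Fin N => {s : Set S | MeasurableSet s}))
    ?_ ?_ ?_ (by simp)
  · refine (generateFrom_eq_prod (@MeasurableSpace.generateFrom_measurableSet E _) generateFrom_pi
      isCountablySpanning_measurableSet ?_).symm
    exact ⟨fun _ => Set.univ, fun _ => ⟨fun _ => Set.univ, by simp, by simp⟩, Set.iUnion_const _⟩
  · exact (@MeasurableSpace.isPiSystem_measurableSet E _).prod isPiSystem_pi
  · rintro _ ⟨s, hs, _, ⟨A, hA, rfl⟩, rfl⟩
    simp only [Set.mem_pi, Set.mem_univ, forall_const, Set.mem_ofPred_eq] at hA hs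
    rw [Measure.map_apply (hZ'.prodMk hY') (hs.prod (MeasurableSet.univ_pi hA)),
      Measure.compProd_apply_prod hs (MeasurableSet.univ_pi hA)]
    have hAm : MeasurableSet (⋂ i, Y i ⁻¹' A i) := MeasurableSet.iInter fun i => hY i (hA i)
    have hset : (fun ω => (Z ω, fun i => Y i ω)) ⁻¹' (s ×ˢ Set.univ.pi A)
        = Z ⁻¹' s ∩ ⋂ i, Y i ⁻¹' A i := by
      ext ω; simp
    have h1 := setIntegral_condExp hm
      (f := (⋂ i, Y i ⁻¹' A i).indicator (fun _ => (1 : ℝ))) (μ := P)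
      ((integrable_const _).indicator hAm) (s := Z ⁻¹' s) (hZ hs)
    rw [setIntegral_congr_ae (hZ' hs) ((hcond A hA).mono fun ω h _ => h),
      setIntegral_indicator hAm] at h1
    simp only [integral_const, MeasurableSet.univ, measureReal_restrict_apply, Set.univ_inter,
      smul_eq_mul, mul_one] at h1
    rw [hset, ← ofReal_measureReal, ← h1,
      ofReal_integral_eq_lintegral_ofReal]
    · rw [setLIntegral_map hs ((piKernel K).measurable_coe (MeasurableSet.univ_pi hA)) hZ']
      refine lintegral_congr fun ω => ?_
      show _ = Measure.pi (fun i => K i (Z ω)) _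
      rw [Measure.pi_pi, ENNReal.ofReal_prod_of_nonneg fun i _ => measureReal_nonneg]
      exact Finset.prod_congr rfl fun i _ => ofReal_measureReal
    · refine Integrable.of_bound (C := 1) ?_ (ae_of_all _ fun ω => ?_)
      · refine Measurable.aestronglyMeasurable ?_
        exact Finset.measurable_prod _ fun i _ =>
          (((K i).measurable_coe (hA i)).comp hZ').ennreal_toReal
      · rw [Real.norm_eq_abs, abs_of_nonneg (Finset.prod_nonneg fun i _ => measureReal_nonneg)]
        exact Finset.prod_le_one (fun i _ => measureReal_nonneg) fun i _ => measureReal_le_one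
    · exact ae_of_all _ fun ω => Finset.prod_nonneg fun i _ => measureReal_nonneg

/-- Hoeffding's inequality for conditionally independent bounded random variables. -/
theorem hoeffding_average_conditional {Ω E S : Type*} {m mΩ : MeasurableSpace Ω}
    [MeasurableSpace E] [MeasurableSpace S] {P : Measure Ω} [IsProbabilityMeasure P] (hm : m ≤ mΩ)
    {N : ℕ} (hN : 1 ≤ N)
    (K : Fin N → Kernel E S) [∀ i, IsMarkovKernel (K i)] {Z : Ω → E} (hZ : Measurable[m] Z)
    {Y : Fin N → Ω → S} (hY : ∀ i, Measurable (Y i))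
    (hcond : ∀ A : Fin N → Set S, (∀ i, MeasurableSet (A i)) →
      P[(⋂ i, Y i ⁻¹' A i).indicator (fun _ => (1 : ℝ)) | m]
        =ᵐ[P] fun ω => ∏ i, (K i (Z ω)).real (A i))
    {φ : S → ℝ} (hφ : Measurable φ) {B : ℝ} (hB : 0 < B) (hb : ∀ x, |φ x| ≤ B)
    {u : ℝ} (hu : 0 ≤ u) :
    P.real {ω | u * B ≤ |(N : ℝ)⁻¹ * ∑ i, φ (Y i ω)
        - (N : ℝ)⁻¹ * ∑ i, ∫ y, φ y ∂(K i (Z ω))|}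
      ≤ 2 * Real.exp (-(N * u ^ 2 / 2)) := by
  have hZ' : Measurable Z := hZ.mono hm le_rfl
  have hY' : Measurable fun ω i => Y i ω := measurable_pi_lambda _ hY
  have : IsProbabilityMeasure (P.map Z) := Measure.isProbabilityMeasure_map hZ'.aemeasurable
  set D : Set (E × (Fin N → S)) := {p | u * B ≤ |(N : ℝ)⁻¹ * ∑ i, φ (p.2 i)
        - (N : ℝ)⁻¹ * ∑ i, ∫ y, φ y ∂(K i p.1)|} with hD
  have hDm : MeasurableSet D := by
    refine measurableSet_le measurable_const ?_
    have h1 : ∀ i, Measurable fun z => ∫ y, φ y ∂(K i z) := fun i =>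
      (hφ.stronglyMeasurable.integral_kernel (κ := K i)).measurable
    have h2 : Measurable fun p : E × (Fin N → S) => ∑ i, φ (p.2 i) :=
      Finset.measurable_sum _ fun i _ => hφ.comp ((measurable_pi_apply i).comp measurable_snd)
    have h3 : Measurable fun p : E × (Fin N → S) => ∑ i, ∫ y, φ y ∂(K i p.1) :=
      Finset.measurable_sum _ fun i _ => (h1 i).comp measurable_fst
    exact _root_.measurable_norm.comp ((h2.const_mul _).sub (h3.const_mul _))
  have hpre : {ω | u * B ≤ |(N : ℝ)⁻¹ * ∑ i, φ (Y i ω)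
        - (N : ℝ)⁻¹ * ∑ i, ∫ y, φ y ∂(K i (Z ω))|}
      = (fun ω => (Z ω, fun i => Y i ω)) ⁻¹' D := rfl
  rw [hpre, ← map_measureReal_apply (hZ'.prodMk hY') hDm, map_pair_eq_compProd hm K hZ hY hcond,
    measureReal_def]
  refine ENNReal.toReal_le_of_le_ofReal (by positivity) ?_
  -- After disintegration, `z` is frozen and the coordinates are independent, so the unconditional
  -- inequality applies on each fibre with a bound that does not depend on `z`.
  rw [Measure.compProd_apply hDm]
  refine (lintegral_mono (g := fun _ => ENNReal.ofReal (2 * Real.exp (-(N * u ^ 2 / 2)))) ?_).trans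
    (by simp)
  intro z
  show Measure.pi (fun i => K i z) _ ≤ _
  rw [← ofReal_measureReal]
  refine ENNReal.ofReal_le_ofReal ?_
  have hI : ∀ i, ∫ y : Fin N → S, φ (y i) ∂(Measure.pi fun i => K i z) = ∫ y, φ y ∂(K i z) :=
    fun i => by
      have := (measurePreserving_eval (fun i => K i z) i)
      rw [← this.map_eq, integral_map this.measurable.aemeasurable
        hφ.aestronglyMeasurable]
  have := hoeffding_average hN (P := Measure.pi fun i => K i z) (ξ := fun i y => φ (y i))
    (iIndepFun_pi (X := fun _ => φ) fun i => hφ.aemeasurable)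
    (fun i => (hφ.comp (measurable_pi_apply i)).aemeasurable) hB (fun i ω => hb _) hu
  simp_rw [hI] at this
  exact this

/-! ### Propagation of concentration through the sampler -/

/-- The empirical measures of the particles `X N 1, …, X N N` approximate `π` with Gaussian tails
at scale `1 / √N`, uniformly over test functions with the same bound. -/
def ExpConcentrates {Ω S : Type*} [MeasurableSpace Ω] [MeasurableSpace S] (P : Measure Ω)
    (π : Measure S) (X : (N : ℕ) → Fin N → Ω → S) : Prop :=
  ∃ a b : ℝ, 0 < a ∧ 0 ≤ b ∧ ∀ N : ℕ, 1 ≤ N → ∀ φ : S → ℝ, Measurable φ → ∀ B : ℝ, 0 < B →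
    (∀ x, |φ x| ≤ B) → ∀ u : ℝ, 0 ≤ u →
      P.real {ω | u * B ≤ |(N : ℝ)⁻¹ * ∑ i, φ (X N i ω) - ∫ x, φ x ∂π|}
        ≤ b * Real.exp (-(a * (N * u ^ 2)))

theorem expConcentrates_of_iid {Ω S : Type*} [MeasurableSpace Ω] [MeasurableSpace S]
    {P : Measure Ω} {π : Measure S} {X : (N : ℕ) → Fin N → Ω → S}
    (hm : ∀ N, 1 ≤ N → ∀ i, Measurable (X N i)) (hind : ∀ N, 1 ≤ N → iIndepFun (X N) P)
    (hlaw : ∀ N, 1 ≤ N → ∀ i, P.map (X N i) = π) : ExpConcentrates P π X := by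
  refine ⟨1 / 2, 2, by norm_num, by norm_num, fun N hN φ hφ B hB hb u hu => ?_⟩
  have h := hoeffding_average hN ((hind N hN).comp (fun _ => φ) fun _ => hφ)
    (fun i => (hφ.comp (hm N hN i)).aemeasurable) hB (fun i ω => hb _) hu
  have hI : ∀ i, ∫ ω, (φ ∘ X N i) ω ∂P = ∫ x, φ x ∂π := fun i => by
    rw [← hlaw N hN i, integral_map (hm N hN i).aemeasurable hφ.aestronglyMeasurable]; rfl
  have hN0 : (N : ℝ) ≠ 0 := by positivity
  simp_rw [hI] at h
  simp only [Finset.sum_const, Finset.card_univ, Fintype.card_fin, nsmul_eq_mul,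
    inv_mul_cancel_left₀ hN0] at h
  rwa [show 1 / 2 * (N * u ^ 2) = N * u ^ 2 / 2 by ring]

theorem history_le {Ω S : Type*} [mΩ : MeasurableSpace Ω] [MeasurableSpace S] {N t : ℕ}
    {X Y : ℕ → Fin N → Ω → S} (hX : ∀ s ≤ t, ∀ i, Measurable (X s i))
    (hY : ∀ s, 1 ≤ s → s ≤ t → ∀ i, Measurable (Y s i)) : history X Y t ≤ mΩ :=
  sup_le (iSup_le fun s => iSup_le fun hs => iSup_le fun i => (hX s hs i).comap_le)
    (iSup_le fun s => iSup_le fun hs => iSup_le fun i => (hY s hs.1 hs.2 i).comap_le)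

theorem measurable_history {Ω S : Type*} [MeasurableSpace S] {N t : ℕ}
    (X Y : ℕ → Fin N → Ω → S) : Measurable[history X Y t] fun ω i => X t i ω := by
  refine (@measurable_pi_iff _ _ _ (history X Y t) _ _).2 fun i => Measurable.of_comap_le ?_
  refine le_trans ?_ le_sup_left
  exact le_iSup_of_le t (le_iSup_of_le le_rfl (le_iSup_of_le i le_rfl))

theorem exp_tail_mono {a a' b v : ℝ} (ha : a' ≤ a) (hb : 0 ≤ b) (hv : 0 ≤ v) :
    b * Real.exp (-(a * v)) ≤ b * Real.exp (-(a' * v)) := by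
  gcongr

/-- Mutation by kernels that move bounded functions by `O(1 / √N)` preserves concentration. -/
theorem ExpConcentrates.jitter {Ω S : Type*} [mΩ : MeasurableSpace Ω] [MeasurableSpace S]
    {P : Measure Ω} [IsProbabilityMeasure P] {π : Measure S} {X Y : (N : ℕ) → Fin N → Ω → S}
    {κ : ℕ → Kernel S S} [∀ N, IsMarkovKernel (κ N)] (hκ : IsJittering κ)
    (hX : ExpConcentrates P π X) (m : ℕ → MeasurableSpace Ω) (hm : ∀ N, 1 ≤ N → m N ≤ mΩ)
    (hXm : ∀ N, 1 ≤ N → Measurable[m N] fun ω i => X N i ω)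
    (hY : ∀ N, 1 ≤ N → ∀ i, Measurable (Y N i))
    (hcond : ∀ N, 1 ≤ N → ∀ A : Fin N → Set S, (∀ i, MeasurableSet (A i)) →
      P[(⋂ i, Y N i ⁻¹' A i).indicator (fun _ => (1 : ℝ)) | m N]
        =ᵐ[P] fun ω => ∏ i, (κ N (X N i ω)).real (A i)) :
    ExpConcentrates P π Y := by
  obtain ⟨a, b, ha, hb0, hX⟩ := hX
  obtain ⟨c₀, hc₀⟩ := hκ
  set c : ℝ := max c₀ 0
  have hc0 : 0 ≤ c := le_max_right _ _
  -- The deviation `u` is split as `u / 4` for the noise of the mutation, `u / 4` for the particles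
  -- before it and `u / 2` for the bias; the first two give the exponents `1 / 32` and `a / 16`.
  set a' : ℝ := min (1 / 32) (a / 16)
  have ha' : 0 < a' := lt_min (by norm_num) (by positivity)
  refine ⟨a', (2 + b) + Real.exp (a' * (4 * c ^ 2)), ha', by positivity,
    fun N hN φ hφ B hB hb u hu => ?_⟩
  have hN0 : (0 : ℝ) < N := by exact_mod_cast hN
  have hs : 0 < √(N : ℝ) := Real.sqrt_pos.2 hN0
  have hNu : 0 ≤ N * u ^ 2 := by positivity
  -- For `u √N < 2 c` the additional constant `exp (4 a' c²)` makes the claimed bound at least `1`.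
  -- Otherwise the bias `c B / √N` is at most `u B / 2`.
  rcases lt_or_ge (u * √(N : ℝ)) (2 * c) with hlt | hge
  · refine measureReal_le_one.trans ?_
    have h1 : N * u ^ 2 ≤ 4 * c ^ 2 := by
      have : N * u ^ 2 = (u * √(N : ℝ)) ^ 2 := by rw [mul_pow, Real.sq_sqrt hN0.le]; ring
      rw [this, show 4 * c ^ 2 = (2 * c) ^ 2 by ring]
      gcongr
    have h2 : (1 : ℝ) ≤ Real.exp (a' * (4 * c ^ 2)) * Real.exp (-(a' * (N * u ^ 2))) := by
      rw [← Real.exp_add]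
      exact Real.one_le_exp (by nlinarith)
    have h3 : 0 ≤ (2 + b) * Real.exp (-(a' * (N * u ^ 2))) := by positivity
    nlinarith
  have hbias : ∀ x, |∫ y, φ y ∂(κ N x) - φ x| ≤ u / 2 * B := fun x => by
    have hint : Integrable φ (κ N x) := Integrable.of_bound hφ.aestronglyMeasurable B
      (ae_of_all _ hb)
    have h1 : ∫ y, φ y ∂(κ N x) - φ x = ∫ y, (φ y - φ x) ∂(κ N x) := by
      rw [integral_sub hint (integrable_const _)]; simp
    rw [h1]
    refine (abs_integral_le_integral_abs).trans ((hc₀ N hN φ hφ B hb x).trans ?_)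
    rw [div_le_iff₀ hs]
    have : c₀ ≤ c := le_max_left _ _
    nlinarith
  have h1 := hoeffding_average_conditional (hm N hN) hN
    (fun i => (κ N).comap (fun z : Fin N → S => z i) (measurable_pi_apply i)) (hXm N hN) (hY N hN)
    (hcond N hN) hφ hB hb (u := u / 4) (by positivity)
  have h2 := hX N hN φ hφ B hB hb (u / 4) (by positivity)
  simp only [Kernel.comap_apply] at h1
  refine (measureReal_mono (s₂ := _ ∪ _) ?_).trans
    ((measureReal_union_le _ _).trans ((add_le_add h1 h2).trans ?_))
  · intro ω hω
    by_contra hcon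
    simp only [Set.mem_union, not_or, Set.mem_ofPred_eq, not_le] at hcon hω
    obtain ⟨g1, g2⟩ := hcon
    have g3 : |(N : ℝ)⁻¹ * ∑ i, ∫ y, φ y ∂(κ N (X N i ω)) - (N : ℝ)⁻¹ * ∑ i, φ (X N i ω)|
        ≤ u / 2 * B := by
      rw [← mul_sub, ← Finset.sum_sub_distrib, abs_mul, abs_of_pos (inv_pos.2 hN0),
        inv_mul_le_iff₀ hN0]
      refine (Finset.abs_sum_le_sum_abs _ _).trans ((Finset.sum_le_sum fun i _ => hbias _).trans ?_)
      simp
    have g4 := abs_sub_le ((N : ℝ)⁻¹ * ∑ i, φ (Y N i ω)) ((N : ℝ)⁻¹ * ∑ i, φ (X N i ω))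
      (∫ x, φ x ∂π)
    have g5 := abs_sub_le ((N : ℝ)⁻¹ * ∑ i, φ (Y N i ω))
      ((N : ℝ)⁻¹ * ∑ i, ∫ y, φ y ∂(κ N (X N i ω))) ((N : ℝ)⁻¹ * ∑ i, φ (X N i ω))
    linarith
  · have e1 := exp_tail_mono (a := 1 / 32) (a' := a') (b := 2) (min_le_left _ _) (by norm_num) hNu
    have e2 := exp_tail_mono (a := a / 16) (a' := a') (b := b) (min_le_right _ _) hb0 hNu
    have e3 : 0 ≤ Real.exp (a' * (4 * c ^ 2)) * Real.exp (-(a' * (N * u ^ 2))) := by positivity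
    have e4 : N * (u / 4) ^ 2 / 2 = 1 / 32 * (N * u ^ 2) := by ring
    have e5 : a * (N * (u / 4) ^ 2) = a / 16 * (N * u ^ 2) := by ring
    rw [e4, e5]
    linarith

theorem isProbabilityMeasure_weightedEmpirical {S : Type*} [MeasurableSpace S] {N : ℕ}
    (hN : 1 ≤ N) {G : S → ℝ} (hG : ∀ x, 0 < G x) (y : Fin N → S) :
    IsProbabilityMeasure (weightedEmpirical G y) := by
  have : Nonempty (Fin N) := ⟨⟨0, hN⟩⟩
  have hpos : 0 < ∑ l, G (y l) := Finset.sum_pos (fun l _ => hG _) Finset.univ_nonempty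
  constructor
  simp only [weightedEmpirical, Measure.coe_finsetSum, Finset.sum_apply, Measure.smul_apply,
    measure_univ, smul_eq_mul, mul_one]
  rw [← ENNReal.ofReal_sum_of_nonneg fun i _ => div_nonneg (hG _).le hpos.le, ← Finset.sum_div,
    div_self hpos.ne', ENNReal.ofReal_one]

theorem integral_weightedEmpirical {S : Type*} [MeasurableSpace S] {N : ℕ} {G : S → ℝ}
    (hG : ∀ x, 0 < G x) (y : Fin N → S) {φ : S → ℝ} (hφ : Measurable φ) :
    ∫ x, φ x ∂(weightedEmpirical G y) = (∑ j, G (y j) * φ (y j)) / ∑ j, G (y j) := by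
  have hpos : 0 ≤ ∑ l, G (y l) := Finset.sum_nonneg fun l _ => (hG _).le
  rw [weightedEmpirical, integral_finsetSum_measure, Finset.sum_div]
  · refine Finset.sum_congr rfl fun j _ => ?_
    rw [integral_smul_measure, integral_dirac' _ _ hφ.stronglyMeasurable,
      ENNReal.toReal_ofReal (div_nonneg (hG _).le hpos), smul_eq_mul]
    ring
  · intro j _
    refine Integrable.smul_measure ?_ ENNReal.ofReal_ne_top
    exact (integrable_dirac' hφ.stronglyMeasurable (by simp))

/-- The weighted empirical measure as a kernel in the positions of the particles. -/
noncomputable def weightedEmpiricalKernel {S : Type*} [MeasurableSpace S] (N : ℕ) (G : S → ℝ)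
    (hG : Measurable G) : Kernel (Fin N → S) S where
  toFun := weightedEmpirical G
  measurable' := by
    refine Measure.measurable_of_measurable_coe _ fun s hs => ?_
    simp only [weightedEmpirical, Measure.coe_finsetSum, Finset.sum_apply, Measure.smul_apply,
      smul_eq_mul, Measure.dirac_apply' _ hs]
    refine Finset.measurable_sum _ fun j _ => Measurable.mul ?_ ?_
    · exact ((hG.comp (measurable_pi_apply j)).div (Finset.measurable_sum _ fun l _ =>
        hG.comp (measurable_pi_apply l))).ennreal_ofReal
    · exact (measurable_const.indicator hs).comp (measurable_pi_apply j)

/-- Since `A' / g'` is bounded by `B`, the error can be written with only the limit `g` in the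
denominator. No lower bound on the random normalization `g'` is needed. -/
theorem ratio_error_bound {A' A g' g B : ℝ} (hg : 0 < g) (hg' : 0 < g') (hA : |A'| ≤ B * g') :
    |A' / g' - A / g| ≤ (|A' - A| + B * |g' - g|) / g := by
  have h1 : A' / g' - A / g = (A' - A) / g - A' / g' * (g' - g) / g := by field_simp; ring
  have h2 : |A' / g'| ≤ B := by rwa [abs_div, abs_of_pos hg', div_le_iff₀ hg']
  rw [h1, ← sub_div, abs_div, abs_of_pos hg]
  gcongr
  refine (abs_sub _ _).trans ?_
  rw [abs_mul]
  gcongr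

/-- Weighting by `G` and multinomial resampling turns concentration around `π` into concentration
around the reweighted measure. -/
theorem ExpConcentrates.resample {Ω S : Type*} [mΩ : MeasurableSpace Ω] [MeasurableSpace S]
    {P : Measure Ω} [IsProbabilityMeasure P] {π π' : Measure S} [IsProbabilityMeasure π]
    {X Y : (N : ℕ) → Fin N → Ω → S} {G : S → ℝ} (hGm : Measurable G) (hG : ∀ x, 0 < G x)
    {M : ℝ} (hGM : ∀ x, G x ≤ M) (hg : 0 < ∫ x, G x ∂π)
    (hπ' : ∀ φ : S → ℝ, Measurable φ → ∫ x, φ x ∂π' = (∫ x, G x * φ x ∂π) / ∫ x, G x ∂π)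
    (hY : ExpConcentrates P π Y) (m : ℕ → MeasurableSpace Ω) (hm : ∀ N, 1 ≤ N → m N ≤ mΩ)
    (hYm : ∀ N, 1 ≤ N → Measurable[m N] fun ω i => Y N i ω)
    (hX : ∀ N, 1 ≤ N → ∀ i, Measurable (X N i))
    (hcond : ∀ N, 1 ≤ N → ∀ A : Fin N → Set S, (∀ i, MeasurableSet (A i)) →
      P[(⋂ i, X N i ⁻¹' A i).indicator (fun _ => (1 : ℝ)) | m N]
        =ᵐ[P] fun ω => ∏ i, (weightedEmpirical G (fun j => Y N j ω)).real (A i)) :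
    ExpConcentrates P π' X := by
  obtain ⟨a, b, ha, hb0, hY⟩ := hY
  set g : ℝ := ∫ x, G x ∂π with hgdef
  obtain ⟨x₀⟩ : Nonempty S := nonempty_of_isProbabilityMeasure π
  have hM : 0 < M := (hG x₀).trans_le (hGM x₀)
  have hGabs : ∀ x, |G x| ≤ M := fun x => by rw [abs_of_pos (hG x)]; exact hGM x
  -- Numerator and denominator each contribute an error `r u M B`. This `r` makes their sum, divided
  -- by `g`, equal to `u B / 2`; the noise of the resampling takes the other half.
  set r : ℝ := g / (4 * M) with hr
  have hr0 : 0 < r := by positivity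
  set a' : ℝ := min (1 / 8) (a * r ^ 2)
  have ha' : 0 < a' := lt_min (by norm_num) (by positivity)
  refine ⟨a', 2 + b + b, ha', by positivity, fun N hN φ hφ B hB hb u hu => ?_⟩
  have hN0 : (0 : ℝ) < N := by exact_mod_cast hN
  have hNu : 0 ≤ N * u ^ 2 := by positivity
  have : Nonempty (Fin N) := ⟨⟨0, hN⟩⟩
  have : IsMarkovKernel (weightedEmpiricalKernel N G hGm) :=
    ⟨fun y => isProbabilityMeasure_weightedEmpirical hN hG y⟩
  have h1 := hoeffding_average_conditional (hm N hN) hN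
    (fun _ => weightedEmpiricalKernel N G hGm) (hYm N hN) (hX N hN)
    (hcond N hN) hφ hB hb (u := u / 2) (by positivity)
  have h2 := hY N hN (fun x => G x * φ x) (hGm.mul hφ) (M * B) (by positivity)
    (fun x => by rw [abs_mul]; exact mul_le_mul (hGabs x) (hb x) (abs_nonneg _) hM.le)
    (r * u) (by positivity)
  have h3 := hY N hN G hGm M hM hGabs (r * u) (by positivity)
  refine (measureReal_mono (s₂ := (_ ∪ _) ∪ _) ?_).trans ((measureReal_union_le _ _).trans
    ((add_le_add ((measureReal_union_le _ _).trans (add_le_add h1 h2)) h3).trans ?_))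
  · intro ω hω
    by_contra hcon
    simp only [Set.mem_union, not_or, Set.mem_ofPred_eq, not_le] at hcon hω
    obtain ⟨⟨g1, g2⟩, g3⟩ := hcon
    have hK : ∫ y, φ y ∂(weightedEmpiricalKernel N G hGm (fun i => Y N i ω))
      = ((N : ℝ)⁻¹ * ∑ j, G (Y N j ω) * φ (Y N j ω)) / ((N : ℝ)⁻¹ * ∑ j, G (Y N j ω)) := by
      rw [mul_div_mul_left _ _ (inv_ne_zero hN0.ne')]
      exact integral_weightedEmpirical hG _ hφ
    simp only [hK, Finset.sum_const, Finset.card_univ, Fintype.card_fin, nsmul_eq_mul,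
      inv_mul_cancel_left₀ hN0.ne'] at g1
    have g4 := ratio_error_bound (A' := (N : ℝ)⁻¹ * ∑ j, G (Y N j ω) * φ (Y N j ω))
      (A := ∫ x, G x * φ x ∂π) (g' := (N : ℝ)⁻¹ * ∑ j, G (Y N j ω)) (B := B) hg
      (mul_pos (inv_pos.2 hN0) (Finset.sum_pos (fun l _ => hG _) Finset.univ_nonempty)) (by
        rw [abs_mul, abs_of_pos (inv_pos.2 hN0), mul_left_comm]
        refine mul_le_mul_of_nonneg_left ?_ (inv_pos.2 hN0).le
        rw [Finset.mul_sum]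
        refine (Finset.abs_sum_le_sum_abs _ _).trans (Finset.sum_le_sum fun j _ => ?_)
        rw [abs_mul, abs_of_pos (hG _), mul_comm]
        exact mul_le_mul_of_nonneg_right (hb _) (hG _).le)
    rw [← hπ' φ hφ] at g4
    have g5 : (|(N : ℝ)⁻¹ * ∑ j, G (Y N j ω) * φ (Y N j ω) - ∫ x, G x * φ x ∂π|
        + B * |(N : ℝ)⁻¹ * ∑ j, G (Y N j ω) - g|) / g < u / 2 * B := by
      rw [div_lt_iff₀ hg]
      have e1 : r * u * (M * B) + B * (r * u * M) = u / 2 * B * g := by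
        rw [hr]; field_simp; ring
      rw [← e1]
      have := mul_lt_mul_of_pos_left g3 hB
      linarith
    have g6 := abs_sub_le ((N : ℝ)⁻¹ * ∑ i, φ (X N i ω))
      (((N : ℝ)⁻¹ * ∑ j, G (Y N j ω) * φ (Y N j ω)) / ((N : ℝ)⁻¹ * ∑ j, G (Y N j ω)))
      (∫ x, φ x ∂π')
    linarith
  · have e1 := exp_tail_mono (a := 1 / 8) (a' := a') (b := 2) (min_le_left _ _) (by norm_num) hNu
    have e2 := exp_tail_mono (a := a * r ^ 2) (a' := a') (b := b) (min_le_right _ _) hb0 hNu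
    have e4 : N * (u / 2) ^ 2 / 2 = 1 / 8 * (N * u ^ 2) := by ring
    have e5 : a * (N * (r * u) ^ 2) = a * r ^ 2 * (N * u ^ 2) := by ring
    rw [e4, e5]
    linarith

/-- The particles of the sampler concentrate around the target measures. -/
theorem expConcentrates_sampler {Ω S : Type*} [mΩ : MeasurableSpace Ω] [MeasurableSpace S]
    {P : Measure Ω} [IsProbabilityMeasure P] {π : ℕ → Measure S}
    {κ : ℕ → Kernel S S} [∀ N, IsMarkovKernel (κ N)] (hκ : IsJittering κ) {G : ℕ → S → ℝ} {T : ℕ}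
    (hπ : ∀ t < T, IsProbabilityMeasure (π t))
    (hGm : ∀ t, Measurable (G t)) (hG : ∀ t x, 0 < G t x)
    (hGM : ∀ t, 1 ≤ t → t ≤ T → ∃ M : ℝ, ∀ x, G t x ≤ M)
    (hg : ∀ t < T, 0 < ∫ x, G (t + 1) x ∂π t)
    (hπ' : ∀ t < T, ∀ φ : S → ℝ, Measurable φ →
      ∫ x, φ x ∂π (t + 1) = (∫ x, G (t + 1) x * φ x ∂π t) / ∫ x, G (t + 1) x ∂π t)
    {X Y : (N : ℕ) → ℕ → Fin N → Ω → S}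
    (hX : ∀ N, 1 ≤ N → IsSampler P (π 0) (κ N) G T N (X N) (Y N)) :
    ∀ t ≤ T, ExpConcentrates P (π t) fun N => X N t := by
  intro t
  induction t with
  | zero =>
    exact fun _ => expConcentrates_of_iid
      (fun N hN => (hX N hN).measurable_particle 0 (Nat.zero_le _))
      (fun N hN => (hX N hN).indep_init) (fun N hN => (hX N hN).law_init)
  | succ t ih =>
    intro ht
    have hlt : t < T := ht
    have hle : ∀ N, 1 ≤ N → history (X N) (Y N) t ≤ mΩ := fun N hN =>
      history_le (fun s hs => (hX N hN).measurable_particle s (hs.trans hlt.le))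
        fun s h1 hs => (hX N hN).measurable_jittered s h1 (hs.trans hlt.le)
    have hYm : ∀ N, 1 ≤ N → ∀ i, Measurable (Y N (t + 1) i) := fun N hN =>
      (hX N hN).measurable_jittered (t + 1) (by omega) ht
    have h1 : ExpConcentrates P (π t) fun N => Y N (t + 1) :=
      (ih hlt.le).jitter hκ (fun N => history (X N) (Y N) t) hle
        (fun N _ => measurable_history (X N) (Y N)) hYm (fun N hN => (hX N hN).jitter t hlt)
    obtain ⟨M, hM⟩ := hGM (t + 1) (by omega) ht
    have := hπ t hlt
    refine h1.resample (hGm (t + 1)) (hG (t + 1)) hM (hg t hlt) (hπ' t hlt)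
      (fun N => history (X N) (Y N) t ⊔ ⨆ i, MeasurableSpace.comap (Y N (t + 1) i) inferInstance)
      (fun N hN => sup_le (hle N hN) (iSup_le fun i => (hYm N hN i).comap_le)) (fun N hN => ?_)
      (fun N hN => (hX N hN).measurable_particle (t + 1) ht)
      (fun N hN => (hX N hN).resample t hlt)
    refine (@measurable_pi_iff _ _ _ (_) _ _).2 fun i => Measurable.of_comap_le ?_
    exact le_trans (le_iSup (fun i => MeasurableSpace.comap (Y N (t + 1) i) inferInstance) i)
      le_sup_right

/-! ### Target densities and target measures -/

theorem potential_pos {S : Type*} {n : ℕ} (f : Fin n → S → ℝ) (J : Finset (Fin n)) (θ : S) :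
    0 < potential f J θ := Real.exp_pos _

theorem measurable_potential {S : Type*} [MeasurableSpace S] {n : ℕ} {f : Fin n → S → ℝ}
    (hf : ∀ i, Measurable (f i)) (J : Finset (Fin n)) : Measurable (potential f J) :=
  (Finset.measurable_sum _ fun i _ => hf i).neg.exp

theorem integral_pos_of_forall_pos {S : Type*} [MeasurableSpace S] {μ : Measure S} (hμ : μ ≠ 0)
    {g : S → ℝ} (hg : ∀ x, 0 < g x) (hint : Integrable g μ) : 0 < ∫ x, g x ∂μ := by
  rw [integral_pos_iff_support_of_nonneg (fun x => (hg x).le) hint]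
  have : Function.support g = Set.univ := Set.eq_univ_of_forall fun x => (hg x).ne'
  rw [this]
  exact Measure.measure_univ_pos.2 hμ

theorem integrable_potential_mul {S : Type*} [MeasurableSpace S] {μ : Measure S} {n : ℕ}
    {f : Fin n → S → ℝ} (hf : ∀ i, Measurable (f i)) {J : Finset (Fin n)} {M : ℝ}
    (hM : ∀ θ, potential f J θ ≤ M) {q : S → ℝ} (hq : Integrable q μ) :
    Integrable (fun θ => potential f J θ * q θ) μ :=
  hq.bdd_mul (c := M) (measurable_potential hf J).aestronglyMeasurable (ae_of_all _ fun θ => by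
    rw [Real.norm_eq_abs, abs_of_pos (potential_pos f J θ)]; exact hM θ)

/-- The target densities are positive probability densities, proportional to the product of the
potentials used so far. -/
theorem targetDensity_spec {S : Type*} [MeasurableSpace S] {μ : Measure S} (hμ : μ ≠ 0) {n : ℕ}
    {f : Fin n → S → ℝ} (hf : ∀ i, Measurable (f i)) {T : ℕ} {I : ℕ → Finset (Fin n)}
    (hprior : Integrable (potential f (I 0)) μ)
    (hG : ∀ t, 1 ≤ t → t ≤ T → ∃ B : ℝ, ∀ θ, potential f (I t) θ ≤ B) :
    ∀ t ≤ T, Measurable (targetDensity μ f I t) ∧ (∀ θ, 0 < targetDensity μ f I t θ) ∧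
      Integrable (targetDensity μ f I t) μ ∧ ∫ θ, targetDensity μ f I t θ ∂μ = 1 ∧
      ∃ c : ℝ, 0 < c ∧ ∀ θ, targetDensity μ f I t θ
        = c * ∏ s ∈ Finset.range (t + 1), potential f (I s) θ := by
  intro t
  induction t with
  | zero =>
    intro _
    have hZ := integral_pos_of_forall_pos hμ (potential_pos f (I 0)) hprior
    refine ⟨(measurable_potential hf _).div_const _, fun θ => div_pos (potential_pos _ _ _) hZ,
      hprior.div_const _, ?_, (∫ θ, potential f (I 0) θ ∂μ)⁻¹, inv_pos.2 hZ, fun θ => ?_⟩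
    · simp only [targetDensity]
      rw [integral_div, div_self hZ.ne']
    · simp [targetDensity, div_eq_inv_mul]
  | succ t ih =>
    intro ht
    obtain ⟨hm, hpos, hint, -, c, hc, hform⟩ := ih (by omega)
    obtain ⟨M, hM⟩ := hG (t + 1) (by omega) ht
    have hint' := integrable_potential_mul hf hM hint
    have hZ := integral_pos_of_forall_pos hμ
      (fun θ => mul_pos (potential_pos f (I (t + 1)) θ) (hpos θ)) hint'
    refine ⟨(hm.mul (measurable_potential hf _)).div_const _,
      fun θ => div_pos (mul_pos (hpos θ) (potential_pos _ _ _)) hZ, ?_, ?_,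
      c / (∫ θ, potential f (I (t + 1)) θ * targetDensity μ f I t θ ∂μ), div_pos hc hZ,
      fun θ => ?_⟩
    · refine Integrable.div_const ?_ _
      simpa only [mul_comm] using hint'
    · simp only [targetDensity]
      rw [integral_div]
      simp_rw [mul_comm (targetDensity μ f I t _)]
      exact div_self hZ.ne'
    · rw [Finset.prod_range_succ, targetDensity]
      beta_reduce
      rw [hform θ]
      ring

/-- The target measure `π_t`. -/
noncomputable def targetMeasure {S : Type*} [MeasurableSpace S] (μ : Measure S) {n : ℕ}
    (f : Fin n → S → ℝ) (I : ℕ → Finset (Fin n)) (t : ℕ) : Measure S :=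
  μ.withDensity fun θ => ENNReal.ofReal (targetDensity μ f I t θ)

theorem integral_targetMeasure {S : Type*} [MeasurableSpace S] {μ : Measure S} {n : ℕ}
    {f : Fin n → S → ℝ} {I : ℕ → Finset (Fin n)} {t : ℕ}
    (hm : Measurable (targetDensity μ f I t)) (hpos : ∀ θ, 0 < targetDensity μ f I t θ)
    (φ : S → ℝ) :
    ∫ θ, φ θ ∂(targetMeasure μ f I t) = ∫ θ, targetDensity μ f I t θ * φ θ ∂μ := by
  rw [targetMeasure, integral_withDensity_eq_integral_toReal_smul hm.ennreal_ofReal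
    (ae_of_all _ fun _ => ENNReal.ofReal_lt_top)]
  refine integral_congr_ae (ae_of_all _ fun θ => ?_)
  simp [ENNReal.toReal_ofReal (hpos θ).le]

theorem isProbabilityMeasure_targetMeasure {S : Type*} [MeasurableSpace S] {μ : Measure S} {n : ℕ}
    {f : Fin n → S → ℝ} {I : ℕ → Finset (Fin n)} {t : ℕ}
    (hpos : ∀ θ, 0 < targetDensity μ f I t θ) (hint : Integrable (targetDensity μ f I t) μ)
    (h1 : ∫ θ, targetDensity μ f I t θ ∂μ = 1) :
    IsProbabilityMeasure (targetMeasure μ f I t) := by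
  constructor
  rw [targetMeasure, withDensity_apply _ MeasurableSet.univ, Measure.restrict_univ,
    ← ofReal_integral_eq_lintegral_ofReal hint (ae_of_all _ fun θ => (hpos θ).le), h1,
    ENNReal.ofReal_one]

/-- The particles of the sampler at time `T` concentrate around `π_T`. -/
theorem expConcentrates_targetMeasure {Ω S : Type*} [MeasurableSpace Ω] [MeasurableSpace S]
    {P : Measure Ω} [IsProbabilityMeasure P] {μ : Measure S} (hμ : μ ≠ 0) {n : ℕ}
    {f : Fin n → S → ℝ} (hf : ∀ i, Measurable (f i)) {T : ℕ} {I : ℕ → Finset (Fin n)}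
    (hprior : Integrable (potential f (I 0)) μ)
    (hG : ∀ t, 1 ≤ t → t ≤ T → ∃ B : ℝ, ∀ θ, potential f (I t) θ ≤ B)
    {κ : ℕ → Kernel S S} [∀ N, IsMarkovKernel (κ N)] (hκ : IsJittering κ)
    {X Y : (N : ℕ) → ℕ → Fin N → Ω → S}
    (hX : ∀ N, 1 ≤ N →
      IsSampler P (prior μ f I) (κ N) (fun t => potential f (I t)) T N (X N) (Y N)) :
    ExpConcentrates P (targetMeasure μ f I T) fun N => X N T := by
  have hspec := targetDensity_spec hμ hf hprior hG
  refine expConcentrates_sampler (π := targetMeasure μ f I) hκ (fun t ht => ?_)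
    (fun t => measurable_potential hf (I t)) (fun t => potential_pos f (I t)) hG
    (fun t ht => ?_) (fun t ht φ hφ => ?_) hX T le_rfl
  · obtain ⟨hm, hpos, hint, h1, -⟩ := hspec t ht.le
    exact isProbabilityMeasure_targetMeasure hpos hint h1
  · obtain ⟨hm, hpos, hint, h1, -⟩ := hspec t ht.le
    obtain ⟨M, hM⟩ := hG (t + 1) (by omega) ht
    rw [integral_targetMeasure hm hpos]
    simp_rw [mul_comm (targetDensity μ f I t _)]
    exact integral_pos_of_forall_pos hμ
      (fun θ => mul_pos (potential_pos f (I (t + 1)) θ) (hpos θ))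
      (integrable_potential_mul hf hM hint)
  · obtain ⟨hm, hpos, -⟩ := hspec t ht.le
    obtain ⟨hm', hpos', -⟩ := hspec (t + 1) ht
    rw [integral_targetMeasure hm hpos, integral_targetMeasure hm hpos,
      integral_targetMeasure hm' hpos', ← integral_div]
    refine integral_congr_ae (ae_of_all _ fun θ => ?_)
    simp only [targetDensity]
    simp_rw [mul_comm (potential f (I (t + 1)) _) (targetDensity μ f I t _)]
    ring

theorem prod_potential_eq {S : Type*} {n : ℕ} (f : Fin n → S → ℝ) {T : ℕ}
    {I : ℕ → Finset (Fin n)}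
    (hI_disj : ∀ s ≤ T, ∀ t ≤ T, s ≠ t → Disjoint (I s) (I t))
    (hI_cover : ∀ i, ∃ t ≤ T, i ∈ I t) (θ : S) :
    ∏ s ∈ Finset.range (T + 1), potential f (I s) θ = Real.exp (-totalCost f θ) := by
  have hU : (Finset.range (T + 1)).biUnion I = Finset.univ := by
    refine Finset.eq_univ_of_forall fun i => ?_
    obtain ⟨t, ht, hi⟩ := hI_cover i
    exact Finset.mem_biUnion.2 ⟨t, Finset.mem_range.2 (by omega), hi⟩
  simp only [potential, totalCost]
  rw [← Real.exp_sum, Finset.sum_neg_distrib, ← hU, Finset.sum_biUnion]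
  intro s hs t ht hst
  simp only [Finset.coe_range, Set.mem_Iio] at hs ht
  exact hI_disj s (by omega) t (by omega) hst

/-! ### Regularity and moments of the smoothing kernel -/

theorem abs_sub_le_of_abs_lineDeriv_le {E : Type*} [NormedAddCommGroup E] [NormedSpace ℝ E]
    {g : E → ℝ} {v : E} (hd : ∀ x, LineDifferentiableAt ℝ g x v) {C : ℝ}
    (hC : ∀ x, |lineDeriv ℝ g x v| ≤ C) (x : E) (t : ℝ) : |g (x + t • v) - g x| ≤ C * |t| := by
  have hder : ∀ s : ℝ, HasDerivAt (fun s : ℝ => g (x + s • v)) (lineDeriv ℝ g (x + s • v) v) s := by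
    intro s
    -- The base point `0` is written as `s - s`, so that `comp_sub_const` translates the derivative
    -- to `s`.
    have h1 : HasDerivAt (fun r : ℝ => g (x + s • v + r • v)) (lineDeriv ℝ g (x + s • v) v)
        (s - s) := by
      rw [sub_self]; exact (hd (x + s • v)).hasLineDerivAt
    have h2 := h1.comp_sub_const s s
    have h3 : (fun r : ℝ => g (x + s • v + (r - s) • v)) = fun r => g (x + r • v) := by
      funext r
      rw [add_assoc, ← add_smul, add_sub_cancel]
    rwa [h3] at h2
  have := Convex.norm_image_sub_le_of_norm_hasDerivWithin_le (s := Set.univ)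
    (fun s _ => (hder s).hasDerivWithinAt) (fun s _ => (hC (x + s • v)))
    convex_univ (Set.mem_univ (0 : ℝ)) (Set.mem_univ t)
  simpa using this

theorem euclideanSpace_eq_sum_single {d : ℕ} (x : EuclideanSpace ℝ (Fin d)) :
    x = ∑ i, x i • EuclideanSpace.single i (1 : ℝ) := by
  ext j
  simp [Finset.sum_apply, Pi.single_apply]

/-- Coordinates are changed one at a time, so bounds on the coordinate derivatives suffice and no
Fréchet differentiability enters. -/
theorem abs_sub_le_sum_of_abs_lineDeriv_le {d : ℕ} {g : EuclideanSpace ℝ (Fin d) → ℝ}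
    (hd : ∀ i x, LineDifferentiableAt ℝ g x (EuclideanSpace.single i 1)) {C : ℝ}
    (hC : ∀ i x, |lineDeriv ℝ g x (EuclideanSpace.single i 1)| ≤ C)
    (x v : EuclideanSpace ℝ (Fin d)) (s : Finset (Fin d)) :
    |g (x + ∑ i ∈ s, v i • EuclideanSpace.single i (1 : ℝ)) - g x| ≤ C * ∑ i ∈ s, |v i| := by
  induction s using Finset.induction_on with
  | empty => simp
  | insert j s hj ih =>
    rw [Finset.sum_insert hj, Finset.sum_insert hj]
    have h1 := abs_sub_le_of_abs_lineDeriv_le (hd j) (hC j)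
      (x + ∑ i ∈ s, v i • EuclideanSpace.single i (1 : ℝ)) (v j)
    rw [add_comm (v j • _), ← add_assoc]
    have := abs_sub_le (g (x + ∑ i ∈ s, v i • EuclideanSpace.single i (1 : ℝ)
      + v j • EuclideanSpace.single j (1 : ℝ)))
      (g (x + ∑ i ∈ s, v i • EuclideanSpace.single i (1 : ℝ))) (g x)
    linarith

theorem SMCOpt.IsSmoothingKernel.exists_lipschitz {d : ℕ} {k : EuclideanSpace ℝ (Fin d) → ℝ}
    (hk : IsSmoothingKernel k) : ∃ Λ : ℝ, 0 ≤ Λ ∧ ∀ x y, |k x - k y| ≤ Λ * ‖x - y‖ := by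
  choose B hB using fun i : Fin d => hk.bounded [i] (by simp)
  have hB0 : ∀ i, 0 ≤ B i := fun i => (abs_nonneg _).trans (hB i 0)
  have hC0 : 0 ≤ ∑ i, B i := Finset.sum_nonneg fun i _ => hB0 i
  refine ⟨(∑ i, B i) * d, by positivity, fun x y => ?_⟩
  have h := abs_sub_le_sum_of_abs_lineDeriv_le (g := k) (C := ∑ i, B i)
    (fun i x => hk.differentiable i [] (by simp) x)
    (fun i x => (hB i x).trans (Finset.single_le_sum (fun i _ => hB0 i) (Finset.mem_univ i)))
    y (x - y) Finset.univ
  rw [← euclideanSpace_eq_sum_single, add_sub_cancel] at h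
  refine h.trans ?_
  rw [mul_assoc]
  refine mul_le_mul_of_nonneg_left ?_ hC0
  refine (Finset.sum_le_sum fun i _ => PiLp.norm_apply_le (x - y) i).trans ?_
  simp

theorem SMCOpt.IsSmoothingKernel.exists_bound {d : ℕ} {k : EuclideanSpace ℝ (Fin d) → ℝ}
    (hk : IsSmoothingKernel k) : ∃ K : ℝ, 0 < K ∧ ∀ x, k x ≤ K := by
  obtain ⟨B, hB⟩ := hk.bounded [] List.Pairwise.nil
  exact ⟨max B 1, by positivity, fun x => (le_abs_self _).trans ((hB x).trans (le_max_left _ _))⟩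

/-- From `‖x‖ ≤ 1 + ‖x‖ ^ 2`. The first moment is the constant in the smoothing bias. -/
theorem SMCOpt.IsSmoothingKernel.integrable_norm_mul {d : ℕ} {k : EuclideanSpace ℝ (Fin d) → ℝ}
    (hk : IsSmoothingKernel k) : Integrable fun x => ‖x‖ * k x := by
  refine (hk.integrable.add hk.integrable_sq).mono'
    (continuous_norm.aestronglyMeasurable.mul hk.integrable.aestronglyMeasurable)
    (ae_of_all _ fun x => ?_)
  have h := hk.nonneg x
  rw [Real.norm_eq_abs, abs_of_nonneg (by positivity)]
  simp only [Pi.add_apply]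
  nlinarith [sq_nonneg (‖x‖ - 1), norm_nonneg x]

/-! ### Mass, Lipschitz constant and first moment of the scaled kernel -/

section scaledKernel

variable {d : ℕ} {k : EuclideanSpace ℝ (Fin d) → ℝ} {h : ℝ}

theorem SMCOpt.IsSmoothingKernel.scaledKernel_nonneg (hk : IsSmoothingKernel k) (hh : 0 < h)
    (x : EuclideanSpace ℝ (Fin d)) : 0 ≤ scaledKernel k h x :=
  mul_nonneg (by positivity) (hk.nonneg _)

theorem scaledKernel_le {K : ℝ} (hK : ∀ x, k x ≤ K) (hh : 0 < h)
    (x : EuclideanSpace ℝ (Fin d)) : scaledKernel k h x ≤ (h ^ d)⁻¹ * K :=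
  mul_le_mul_of_nonneg_left (hK _) (by positivity)

theorem abs_scaledKernel_sub_le {Λ : ℝ} (hΛ : ∀ x y, |k x - k y| ≤ Λ * ‖x - y‖) (hh : 0 < h)
    (x y : EuclideanSpace ℝ (Fin d)) :
    |scaledKernel k h x - scaledKernel k h y| ≤ (h ^ (d + 1))⁻¹ * Λ * ‖x - y‖ := by
  rw [scaledKernel, scaledKernel, ← mul_sub, abs_mul, abs_of_pos (by positivity : 0 < (h ^ d)⁻¹)]
  have h1 := hΛ (h⁻¹ • x) (h⁻¹ • y)
  rw [← smul_sub, norm_smul, Real.norm_eq_abs, abs_of_pos (inv_pos.2 hh)] at h1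
  calc (h ^ d)⁻¹ * |k (h⁻¹ • x) - k (h⁻¹ • y)| ≤ (h ^ d)⁻¹ * (Λ * (h⁻¹ * ‖x - y‖)) := by gcongr
    _ = _ := by rw [pow_succ, mul_inv]; ring

theorem integral_comp_inv_smul_sub (hh : 0 < h) (g : EuclideanSpace ℝ (Fin d) → ℝ)
    (θ : EuclideanSpace ℝ (Fin d)) :
    ∫ y, (h ^ d)⁻¹ * g (h⁻¹ • (θ - y)) = ∫ x, g x := by
  rw [integral_const_mul, integral_sub_left_eq_self (fun y => g (h⁻¹ • y)) volume θ,
    Measure.integral_comp_smul, finrank_euclideanSpace_fin, abs_of_pos (by positivity), smul_eq_mul,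
    inv_pow, inv_inv, inv_mul_cancel_left₀ (by positivity)]

theorem integrable_comp_inv_smul_sub (hh : 0 < h) {g : EuclideanSpace ℝ (Fin d) → ℝ}
    (hg : Integrable g) (θ : EuclideanSpace ℝ (Fin d)) :
    Integrable fun y => (h ^ d)⁻¹ * g (h⁻¹ • (θ - y)) :=
  ((hg.comp_smul (inv_ne_zero hh.ne')).comp_sub_left θ).const_mul _

theorem SMCOpt.IsSmoothingKernel.integrable_scaledKernel_sub (hk : IsSmoothingKernel k) (hh : 0 < h)
    (θ : EuclideanSpace ℝ (Fin d)) : Integrable fun y => scaledKernel k h (θ - y) :=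
  integrable_comp_inv_smul_sub hh hk.integrable θ

theorem SMCOpt.IsSmoothingKernel.integral_scaledKernel_sub (hk : IsSmoothingKernel k) (hh : 0 < h)
    (θ : EuclideanSpace ℝ (Fin d)) : ∫ y, scaledKernel k h (θ - y) = 1 :=
  (integral_comp_inv_smul_sub hh k θ).trans hk.integral_eq_one

theorem norm_mul_scaledKernel (hh : 0 < h) (x : EuclideanSpace ℝ (Fin d)) :
    ‖x‖ * scaledKernel k h x = h * ((h ^ d)⁻¹ * (‖h⁻¹ • x‖ * k (h⁻¹ • x))) := by
  rw [norm_smul, Real.norm_eq_abs, abs_of_pos (inv_pos.2 hh), scaledKernel]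
  field_simp

theorem SMCOpt.IsSmoothingKernel.integrable_norm_mul_scaledKernel_sub (hk : IsSmoothingKernel k)
    (hh : 0 < h) (θ : EuclideanSpace ℝ (Fin d)) :
    Integrable fun y => ‖θ - y‖ * scaledKernel k h (θ - y) := by
  simp_rw [norm_mul_scaledKernel hh]
  exact (integrable_comp_inv_smul_sub hh hk.integrable_norm_mul θ).const_mul h

/-- The change of variables releases one factor `h`, which is the order of the smoothing bias. -/
theorem SMCOpt.IsSmoothingKernel.integral_norm_mul_scaledKernel_sub (hh : 0 < h)
    (θ : EuclideanSpace ℝ (Fin d)) :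
    ∫ y, ‖θ - y‖ * scaledKernel k h (θ - y) = h * ∫ x, ‖x‖ * k x := by
  simp_rw [norm_mul_scaledKernel hh]
  rw [integral_const_mul]
  congr 1
  exact integral_comp_inv_smul_sub hh (fun x => ‖x‖ * k x) θ

end scaledKernel

/-! ### Bias of smoothing a Lipschitz density on `Θ` -/

section smoothing

variable {d : ℕ} {Θ : Set (EuclideanSpace ℝ (Fin d))} {ρ : EuclideanSpace ℝ (Fin d) → ℝ}
  {θ : Θ} {q : Θ → ℝ} {L : NNReal}

theorem integral_lebesgueOn (hΘ : MeasurableSet Θ) (g : EuclideanSpace ℝ (Fin d) → ℝ) :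
    ∫ y : Θ, g y ∂(lebesgueOn Θ) = ∫ y in Θ, g y :=
  integral_subtype_comap hΘ g

theorem integrable_lebesgueOn (hΘ : MeasurableSet Θ) {g : EuclideanSpace ℝ (Fin d) → ℝ}
    (hg : Integrable g) : Integrable (fun y : Θ => g y) (lebesgueOn Θ) :=
  (MeasurableEmbedding.subtype_coe hΘ).integrable_map_iff.1 (by
    rw [lebesgueOn, map_comap_subtype_coe hΘ]; exact hg.restrict)

/-- A Lipschitz function averaged over `Θ` with the probability density `ρ` exceeds its value at
`θ` by at most the Lipschitz constant times the mean distance to `θ`. -/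
theorem integral_mul_le_of_lipschitz (hΘ : MeasurableSet Θ) (hρ0 : ∀ y, 0 ≤ ρ y)
    (hρ : Integrable ρ) (hρ1 : ∫ y, ρ y = 1)
    (hρd : Integrable fun y => ‖(θ : EuclideanSpace ℝ (Fin d)) - y‖ * ρ y)
    (hq : LipschitzWith L q) (hq0 : ∀ y, 0 ≤ q y)
    (hint : Integrable (fun y : Θ => q y * ρ y) (lebesgueOn Θ)) :
    ∫ y : Θ, q y * ρ y ∂(lebesgueOn Θ)
      ≤ q θ + L * ∫ y, ‖(θ : EuclideanSpace ℝ (Fin d)) - y‖ * ρ y := by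
  have hg : Integrable fun y => q θ * ρ y + L * (‖(θ : EuclideanSpace ℝ (Fin d)) - y‖ * ρ y) :=
    (hρ.const_mul _).add (hρd.const_mul _)
  calc ∫ y : Θ, q y * ρ y ∂(lebesgueOn Θ)
      ≤ ∫ y : Θ, (q θ * ρ y + L * (‖(θ : EuclideanSpace ℝ (Fin d)) - y‖ * ρ y))
          ∂(lebesgueOn Θ) := by
        refine integral_mono hint (integrable_lebesgueOn hΘ hg) fun y => ?_
        have h1 := hq.dist_le_mul y θ
        rw [Real.dist_eq, Subtype.dist_eq, dist_comm, dist_eq_norm] at h1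
        have h2 := (abs_le.1 h1).2
        have := mul_le_mul_of_nonneg_right h2 (hρ0 y)
        simp only
        linarith
    _ = ∫ y in Θ, (q θ * ρ y + L * (‖(θ : EuclideanSpace ℝ (Fin d)) - y‖ * ρ y)) :=
        integral_lebesgueOn hΘ
          fun y => q θ * ρ y + L * (‖(θ : EuclideanSpace ℝ (Fin d)) - y‖ * ρ y)
    _ ≤ ∫ y, (q θ * ρ y + L * (‖(θ : EuclideanSpace ℝ (Fin d)) - y‖ * ρ y)) := by
        refine setIntegral_le_integral hg (ae_of_all _ fun y => ?_)
        have := hρ0 y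
        have := hq0 θ
        simp only [Pi.zero_apply]
        positivity
    _ = _ := by
        rw [integral_add (hρ.const_mul _) (hρd.const_mul _), integral_const_mul,
          integral_const_mul, hρ1, mul_one]

/-- The lower bound that matches `integral_mul_le_of_lipschitz`, at interior points of `Θ`. -/
theorem le_integral_mul_of_lipschitz (hΘ : MeasurableSet Θ) (hρ0 : ∀ y, 0 ≤ ρ y)
    (hρ : Integrable ρ) (hρ1 : ∫ y, ρ y = 1)
    (hρd : Integrable fun y => ‖(θ : EuclideanSpace ℝ (Fin d)) - y‖ * ρ y)
    (hq : LipschitzWith L q) (hq0 : ∀ y, 0 ≤ q y)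
    (hint : Integrable (fun y : Θ => q y * ρ y) (lebesgueOn Θ)) {r : ℝ} (hr : 0 < r)
    (hball : Metric.ball (θ : EuclideanSpace ℝ (Fin d)) r ⊆ Θ) :
    q θ - (q θ / r + L) * ∫ y, ‖(θ : EuclideanSpace ℝ (Fin d)) - y‖ * ρ y
      ≤ ∫ y : Θ, q y * ρ y ∂(lebesgueOn Θ) := by
  set D := ∫ y, ‖(θ : EuclideanSpace ℝ (Fin d)) - y‖ * ρ y with hD
  have hg : Integrable fun y => q θ * ρ y - L * (‖(θ : EuclideanSpace ℝ (Fin d)) - y‖ * ρ y) :=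
    (hρ.const_mul _).sub (hρd.const_mul _)
  have h1 : ∫ y in Θ, (q θ * ρ y - L * (‖(θ : EuclideanSpace ℝ (Fin d)) - y‖ * ρ y))
      ≤ ∫ y : Θ, q y * ρ y ∂(lebesgueOn Θ) := by
    rw [← integral_lebesgueOn hΘ
      (fun y => q θ * ρ y - L * (‖(θ : EuclideanSpace ℝ (Fin d)) - y‖ * ρ y))]
    refine integral_mono (integrable_lebesgueOn hΘ hg) hint fun y => ?_
    have h1 := hq.dist_le_mul y θ
    rw [Real.dist_eq, Subtype.dist_eq, dist_comm, dist_eq_norm] at h1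
    have h2 := (abs_le.1 h1).1
    have := mul_le_mul_of_nonneg_right h2 (hρ0 y)
    simp only
    linarith
  -- Markov's inequality: points outside `Θ` are at distance at least `r` from `θ`. This bounds the
  -- mass lost by truncation to `Θ`.
  have h2 : ∫ y in Θᶜ, ρ y ≤ D / r := by
    rw [le_div_iff₀ hr, ← integral_mul_const]
    refine (setIntegral_mono_on (hρ.mul_const r).integrableOn hρd.integrableOn hΘ.compl
      fun y hy => ?_).trans (setIntegral_le_integral hρd (ae_of_all _ fun y => ?_))
    · rw [mul_comm]
      refine mul_le_mul_of_nonneg_right ?_ (hρ0 y)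
      by_contra hcon
      refine hy (hball ?_)
      rw [Metric.mem_ball, dist_comm, dist_eq_norm]
      exact not_le.1 hcon
    · exact mul_nonneg (norm_nonneg _) (hρ0 y)
  have h3 : ∫ y in Θ, ‖(θ : EuclideanSpace ℝ (Fin d)) - y‖ * ρ y ≤ D :=
    setIntegral_le_integral hρd (ae_of_all _ fun y => mul_nonneg (norm_nonneg _) (hρ0 y))
  have h4 := integral_add_compl hΘ hρ
  rw [integral_sub (hρ.const_mul _).integrableOn (hρd.const_mul _).integrableOn,
    integral_const_mul, integral_const_mul] at h1
  have h5 := mul_le_mul_of_nonneg_left h2 (hq0 θ)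
  have h6 := mul_le_mul_of_nonneg_left h3 L.coe_nonneg
  have h7 : ∫ y in Θ, ρ y = 1 - ∫ y in Θᶜ, ρ y := by linarith
  rw [h7] at h1
  have h8 : (q θ / r + L) * D = q θ * (D / r) + L * D := by ring
  rw [h8]
  linarith

end smoothing

/-! ### Covering nets and the floor in the bandwidth -/

/-- Bounded sets have nets of mesh `d / N` with `O(N ^ d)` points. -/
theorem exists_finset_net {d : ℕ} {Θ : Set (EuclideanSpace ℝ (Fin d))}
    (hΘ : Bornology.IsBounded Θ) : ∃ C : ℝ, 0 ≤ C ∧ ∀ N : ℕ, 1 ≤ N →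
      ∃ Z : Finset (EuclideanSpace ℝ (Fin d)), (Z.card : ℝ) ≤ C * (N : ℝ) ^ d ∧
        ∀ θ ∈ Θ, ∃ z ∈ Z, ‖θ - z‖ ≤ d / N := by
  classical
  obtain ⟨R₀, hR₀⟩ := hΘ.exists_norm_le
  obtain ⟨R, hR⟩ := exists_nat_ge R₀
  refine ⟨(2 * R + 1) ^ d, by positivity, fun N hN => ?_⟩
  have hN0 : (0 : ℝ) < N := by exact_mod_cast hN
  -- The net is the grid of spacing `1 / N` in the cube `[-R, R]ᵈ`. Rounding down moves each
  -- coordinate by at most `1 / N`, hence the point by at most `d / N`.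
  refine ⟨(Fintype.piFinset fun _ : Fin d => Finset.Icc (-(R * N : ℤ)) (R * N)).image
    fun z => WithLp.toLp 2 fun i => (z i : ℝ) / N, ?_, fun θ hθ => ?_⟩
  · have h1 : (Fintype.piFinset fun _ : Fin d => Finset.Icc (-(R * N : ℤ)) (R * N)).card
        = (2 * R * N + 1) ^ d := by
      rw [Fintype.card_piFinset]
      simp only [Int.card_Icc, Finset.prod_const, Finset.card_univ, Fintype.card_fin]
      congr 1
      rw [show (R * N : ℤ) + 1 - -(R * N) = ((2 * R * N + 1 : ℕ) : ℤ) by push_cast; ring]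
      exact Int.toNat_natCast _
    calc _ ≤ ((2 * R * N + 1 : ℕ) : ℝ) ^ d := by
          have := Finset.card_image_le (s := Fintype.piFinset fun _ : Fin d =>
            Finset.Icc (-(R * N : ℤ)) (R * N))
            (f := fun z => (WithLp.toLp 2 fun i => (z i : ℝ) / N : EuclideanSpace ℝ (Fin d)))
          rw [h1] at this
          exact_mod_cast this
      _ ≤ ((2 * R + 1) * N) ^ d := by
          have : (1 : ℝ) ≤ N := by exact_mod_cast hN
          push_cast
          gcongr
          linarith
      _ = _ := mul_pow _ _ _
  · refine ⟨_, Finset.mem_image_of_mem _ ((Fintype.mem_piFinset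
      (f := fun i => ⌊N * θ i⌋)).2 fun i => ?_), ?_⟩
    · have h1 : |θ i| ≤ R := (PiLp.norm_apply_le θ i).trans ((hR₀ θ hθ).trans hR)
      have h2 := abs_le.1 h1
      rw [Finset.mem_Icc]
      constructor
      · rw [Int.le_floor]; push_cast; nlinarith
      · have h3 : (⌊N * θ i⌋ : ℝ) ≤ R * N := (Int.floor_le _).trans (by nlinarith)
        exact_mod_cast h3
    · rw [euclideanSpace_eq_sum_single (θ - _)]
      refine (norm_sum_le _ _).trans ?_
      have : ∀ i : Fin d, ‖(θ - WithLp.toLp 2 fun i => (⌊N * θ i⌋ : ℝ) / N :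
          EuclideanSpace ℝ (Fin d)) i • EuclideanSpace.single i (1 : ℝ)‖ ≤ 1 / N := fun i => by
        rw [norm_smul, PiLp.norm_single, norm_one, mul_one, Real.norm_eq_abs]
        simp only [PiLp.sub_apply]
        have e1 := Int.floor_le (N * θ i)
        have e2 := Int.lt_floor_add_one (N * θ i)
        have e3 : θ i - (⌊N * θ i⌋ : ℝ) / N = (N * θ i - ⌊N * θ i⌋) / N := by field_simp
        rw [e3, abs_div, abs_of_pos hN0]
        gcongr
        rw [abs_le]; constructor <;> linarith
      refine (Finset.sum_le_sum fun i _ => this i).trans ?_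
      simp [div_eq_mul_inv]

theorem le_two_mul_natFloor {s : ℝ} (hs : 1 ≤ s) : s ≤ 2 * (⌊s⌋₊ : ℝ) := by
  have h1 : (1 : ℝ) ≤ ⌊s⌋₊ := by exact_mod_cast Nat.one_le_floor_iff _ |>.2 hs
  have h2 := Nat.lt_floor_add_one s
  linarith

/-! ### Density gap at the particle maximizing the estimator -/

section gap

variable {d : ℕ} {Θ : Set (EuclideanSpace ℝ (Fin d))} {k : EuclideanSpace ℝ (Fin d) → ℝ}
  {q : Θ → ℝ} {L : NNReal}

theorem integrable_mul_scaledKernel_sub (hk : IsSmoothingKernel k) {h : ℝ} (hh : 0 < h)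
    (hq : Integrable q (lebesgueOn Θ)) (z : EuclideanSpace ℝ (Fin d)) :
    Integrable (fun y : Θ => q y * scaledKernel k h (z - y)) (lebesgueOn Θ) := by
  obtain ⟨K, hK0, hK⟩ := hk.exists_bound
  have hc : Continuous k := hk.continuous [] List.Pairwise.nil
  refine hq.mul_bdd (c := (h ^ d)⁻¹ * K) ?_ (ae_of_all _ fun y => ?_)
  · refine Continuous.aestronglyMeasurable ?_
    unfold scaledKernel
    fun_prop
  · rw [Real.norm_eq_abs, abs_of_nonneg (hk.scaledKernel_nonneg hh _)]
    exact scaledKernel_le hK hh _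

/-- The Lipschitz bound for the scaled kernel survives averaging against a probability density.
Together with its analogue for the particles, it carries deviation bounds from a net point to its
neighbours. -/
theorem abs_integral_mul_scaledKernel_sub_le (hk : IsSmoothingKernel k) {h : ℝ} (hh : 0 < h)
    (hq : Integrable q (lebesgueOn Θ)) (hq0 : ∀ y, 0 ≤ q y) (hq1 : ∫ y, q y ∂(lebesgueOn Θ) = 1)
    {Λ : ℝ} (hΛ : ∀ x y, |k x - k y| ≤ Λ * ‖x - y‖) (x z : EuclideanSpace ℝ (Fin d)) :
    |∫ y : Θ, q y * scaledKernel k h (x - y) ∂(lebesgueOn Θ)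
      - ∫ y : Θ, q y * scaledKernel k h (z - y) ∂(lebesgueOn Θ)|
      ≤ (h ^ (d + 1))⁻¹ * Λ * ‖x - z‖ := by
  rw [← integral_sub (integrable_mul_scaledKernel_sub hk hh hq x)
    (integrable_mul_scaledKernel_sub hk hh hq z)]
  rw [← Real.norm_eq_abs]
  refine (norm_integral_le_of_norm_le (hq.mul_const ((h ^ (d + 1))⁻¹ * Λ * ‖x - z‖))
    (ae_of_all _ fun y => ?_)).trans ?_
  · rw [← mul_sub, norm_mul, Real.norm_eq_abs, abs_of_nonneg (hq0 y)]
    refine mul_le_mul_of_nonneg_left ?_ (hq0 y)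
    have := abs_scaledKernel_sub_le hΛ hh (x - y) (z - y)
    rwa [sub_sub_sub_cancel_right] at this
  · rw [integral_mul_const, hq1, one_mul]

theorem abs_average_scaledKernel_sub_le {N : ℕ} (hN : 1 ≤ N) {h : ℝ} (hh : 0 < h)
    {Λ : ℝ} (hΛ : ∀ x y, |k x - k y| ≤ Λ * ‖x - y‖) (x : Fin N → Θ)
    (y z : EuclideanSpace ℝ (Fin d)) :
    |(N : ℝ)⁻¹ * ∑ i, scaledKernel k h (y - x i) - (N : ℝ)⁻¹ * ∑ i, scaledKernel k h (z - x i)|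
      ≤ (h ^ (d + 1))⁻¹ * Λ * ‖y - z‖ := by
  have hN0 : (0 : ℝ) < N := by exact_mod_cast hN
  rw [← mul_sub, ← Finset.sum_sub_distrib, abs_mul, abs_of_pos (inv_pos.2 hN0),
    inv_mul_le_iff₀ hN0]
  refine (Finset.abs_sum_le_sum_abs _ _).trans ((Finset.sum_le_sum fun i _ =>
    abs_scaledKernel_sub_le hΛ hh (y - x i) (z - x i)).trans ?_)
  simp only [sub_sub_sub_cancel_right]
  simp

/-- If the density estimator is uniformly `η`-close to the smoothed density and some particle is
close to the interior point `θ₀`, then the density at a maximizing particle is not much smaller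
than at `θ₀`. -/
theorem density_gap_le (hΘ : MeasurableSet Θ) (hk : IsSmoothingKernel k)
    (hq : Integrable q (lebesgueOn Θ)) (hq0 : ∀ y, 0 ≤ q y) {Q : ℝ} (hQ : ∀ y, q y ≤ Q)
    (hL : LipschitzWith L q) {N : ℕ} {x : Fin N → Θ} {h η r : ℝ} (hh : 0 < h) (hh1 : h ≤ 1)
    (hr : 0 < r) {θ₀ : Θ} (hball : Metric.ball (θ₀ : EuclideanSpace ℝ (Fin d)) (2 * r) ⊆ Θ)
    {p : Θ → ℝ}
    (hη : ∀ θ : Θ, |p θ - ∫ y : Θ, q y * scaledKernel k h (θ - y) ∂(lebesgueOn Θ)| ≤ η)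
    {i₀ i : Fin N} (hi₀ : ‖(x i₀ : EuclideanSpace ℝ (Fin d)) - θ₀‖ < r * h)
    (hi : p (x i₀) ≤ p (x i)) :
    q θ₀ - q (x i) ≤ 2 * η + ((Q / r + 2 * L) * (∫ z, ‖z‖ * k z) + L * r) * h := by
  have hup := integral_mul_le_of_lipschitz (θ := x i) hΘ
    (fun y => hk.scaledKernel_nonneg hh ((x i : EuclideanSpace ℝ (Fin d)) - y))
    (hk.integrable_scaledKernel_sub hh _) (hk.integral_scaledKernel_sub hh _)
    (hk.integrable_norm_mul_scaledKernel_sub hh _) hL hq0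
    (integrable_mul_scaledKernel_sub hk hh hq _)
  -- As `h ≤ 1`, the particle `x i₀` lies within `r` of `θ₀`, so the ball of radius `r` around it
  -- stays in `Θ`.
  have hlow := le_integral_mul_of_lipschitz (θ := x i₀) hΘ
    (fun y => hk.scaledKernel_nonneg hh ((x i₀ : EuclideanSpace ℝ (Fin d)) - y))
    (hk.integrable_scaledKernel_sub hh _) (hk.integral_scaledKernel_sub hh _)
    (hk.integrable_norm_mul_scaledKernel_sub hh _) hL hq0
    (integrable_mul_scaledKernel_sub hk hh hq _) hr (by
      refine (Metric.ball_subset_ball' ?_).trans hball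
      rw [dist_eq_norm]
      nlinarith)
  rw [IsSmoothingKernel.integral_norm_mul_scaledKernel_sub hh] at hup hlow
  set M := ∫ z, ‖z‖ * k z with hM
  have hM0 : 0 ≤ M := integral_nonneg fun z => mul_nonneg (norm_nonneg _) (hk.nonneg z)
  have h1 := (abs_le.1 (hη (x i))).2
  have h2 := (abs_le.1 (hη (x i₀))).1
  have h3 : q θ₀ - q (x i₀) ≤ L * (r * h) := by
    have h4 := hL.dist_le_mul θ₀ (x i₀)
    rw [Real.dist_eq, Subtype.dist_eq, dist_comm, dist_eq_norm] at h4
    exact (le_abs_self _).trans (h4.trans (mul_le_mul_of_nonneg_left hi₀.le L.coe_nonneg))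
  have h5 : q (x i₀) / r * (h * M) ≤ Q / r * (h * M) := by
    gcongr
    exact hQ _
  have e1 : (q (x i₀) / r + L) * (h * M) = q (x i₀) / r * (h * M) + L * (h * M) := by ring
  have e2 : ((Q / r + 2 * L) * M + L * r) * h
      = Q / r * (h * M) + 2 * (L * (h * M)) + L * (r * h) := by ring
  rw [e1] at hlow
  rw [e2]
  linarith

/-- With radius `r h` this bounds the target mass near `θ₀` below by a multiple of `hᵈ`, which
forces a particle into the ball. -/
theorem integral_indicator_ball_ge (hΘ : MeasurableSet Θ) (hq : Integrable q (lebesgueOn Θ))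
    {q₀ : ℝ} (hqlow : ∀ y, q₀ ≤ q y) {θ₀ : EuclideanSpace ℝ (Fin d)} {ρ : ℝ}
    (hρ : 0 < ρ) (hball : Metric.ball θ₀ ρ ⊆ Θ) :
    q₀ * (ρ ^ d * volume.real (Metric.ball (0 : EuclideanSpace ℝ (Fin d)) 1))
      ≤ ∫ y : Θ, q y * (Metric.ball θ₀ ρ).indicator (fun _ => (1 : ℝ)) (y : EuclideanSpace ℝ (Fin d))
          ∂(lebesgueOn Θ) := by
  have h1 : volume.real (Metric.ball θ₀ ρ)
      = ρ ^ d * volume.real (Metric.ball (0 : EuclideanSpace ℝ (Fin d)) 1) := by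
    rw [measureReal_def, Measure.addHaar_ball_of_pos _ _ hρ, ENNReal.toReal_mul,
      ENNReal.toReal_ofReal (by positivity), finrank_euclideanSpace_fin, measureReal_def]
  have hind : Integrable ((Metric.ball θ₀ ρ).indicator (fun _ => (1 : ℝ))) :=
    (integrable_indicator_iff Metric.isOpen_ball.measurableSet).2
      (integrableOn_const (measure_ball_lt_top.ne))
  have h2 : ∫ y : Θ, q₀ * (Metric.ball θ₀ ρ).indicator (fun _ => (1 : ℝ))
      (y : EuclideanSpace ℝ (Fin d)) ∂(lebesgueOn Θ) = q₀ * volume.real (Metric.ball θ₀ ρ) := by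
    rw [integral_const_mul, integral_lebesgueOn hΘ
      ((Metric.ball θ₀ ρ).indicator (fun _ => (1 : ℝ))),
      setIntegral_indicator Metric.isOpen_ball.measurableSet, Set.inter_eq_self_of_subset_right hball]
    simp
  rw [← h1, ← h2]
  have hm : Measurable fun y : Θ => (Metric.ball θ₀ ρ).indicator (fun _ => (1 : ℝ))
      (y : EuclideanSpace ℝ (Fin d)) :=
    (measurable_const.indicator Metric.isOpen_ball.measurableSet).comp measurable_subtype_coe
  refine integral_mono ((integrable_lebesgueOn hΘ hind).const_mul q₀)
    (hq.mul_bdd (c := 1) hm.aestronglyMeasurable (ae_of_all _ fun y => ?_)) fun y => ?_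
  · refine (norm_indicator_le_norm_self _ _).trans (by simp)
  · exact mul_le_mul_of_nonneg_right (hqlow y) (Set.indicator_nonneg (fun _ _ => zero_le_one) _)

set_option maxHeartbeats 400000 in
/-- Tail bound for the difference between the density at an interior point and the density at a
particle that maximizes the density estimator. -/
theorem exists_density_gap_tail {Ω : Type*} [MeasurableSpace Ω] {P : Measure Ω}
    [IsProbabilityMeasure P] (hΘ : IsCompact Θ) (hk : IsSmoothingKernel k)
    (hq : Integrable q (lebesgueOn Θ)) (hq1 : ∫ y, q y ∂(lebesgueOn Θ) = 1) {q₀ Q : ℝ}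
    (hq₀ : 0 < q₀) (hqlow : ∀ y, q₀ ≤ q y) (hQ : ∀ y, q y ≤ Q) (hL : LipschitzWith L q)
    {π : Measure Θ} (hπ : ∀ φ : Θ → ℝ, ∫ y, φ y ∂π = ∫ y, q y * φ y ∂(lebesgueOn Θ))
    {X : (N : ℕ) → Fin N → Ω → Θ} (hX : ExpConcentrates P π X) {θ₀ : Θ}
    (hint : (θ₀ : EuclideanSpace ℝ (Fin d)) ∈ interior Θ) {est : ℕ → Ω → Θ}
    (hest : ∀ N, 1 ≤ N → ∀ᵐ ω ∂P, ∃ i, est N ω = X N i ω ∧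
      ∀ j, kde k (fun l => X N l ω) (X N j ω) ≤ kde k (fun l => X N l ω) (X N i ω))
    {ε : ℝ} (hε0 : 0 < ε) (hε1 : ε < 1) :
    ∃ C C₁ a : ℝ, 0 ≤ C ∧ 0 ≤ C₁ ∧ 0 < a ∧ ∀ N : ℕ, 1 ≤ N →
      P.real {ω | C / (N : ℝ) ^ ((1 - ε) / (2 * ((d : ℝ) + 1))) < q θ₀ - q (est N ω)}
        ≤ C₁ * (N : ℝ) ^ d * Real.exp (-(a * (N : ℝ) ^ (ε / ((d : ℝ) + 1)))) := by
  have hΘm := hΘ.measurableSet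
  have hq0 : ∀ y, 0 ≤ q y := fun y => hq₀.le.trans (hqlow y)
  obtain ⟨a, b, ha, hb, hconc⟩ := hX
  obtain ⟨K, hK0, hK⟩ := hk.exists_bound
  obtain ⟨Λ, hΛ0, hΛ⟩ := hk.exists_lipschitz
  obtain ⟨A, hA0, hnet⟩ := exists_finset_net hΘ.isBounded
  obtain ⟨r, hr, hball⟩ : ∃ r, 0 < r ∧ Metric.ball (θ₀ : EuclideanSpace ℝ (Fin d)) (2 * r) ⊆ Θ := by
    obtain ⟨r, hr, hb⟩ := Metric.mem_nhds_iff.1 (mem_interior_iff_mem_nhds.1 hint)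
    exact ⟨r / 2, by positivity, by rwa [mul_div_cancel₀ _ (two_ne_zero)]⟩
  set M := ∫ z, ‖z‖ * k z with hM
  have hM0 : 0 ≤ M := integral_nonneg fun z => mul_nonneg (norm_nonneg _) (hk.nonneg z)
  have hQ0 : 0 ≤ Q := (hq0 θ₀).trans (hQ θ₀)
  set V := volume.real (Metric.ball (0 : EuclideanSpace ℝ (Fin d)) 1) with hV
  have hV0 : 0 < V := ENNReal.toReal_pos (Metric.measure_ball_pos _ _ one_pos).ne'
    measure_ball_lt_top.ne
  set v := q₀ * (r ^ d * V) with hv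
  have hv0 : 0 < v := by positivity
  set D := (Q / r + 2 * L) * M + L * r with hD
  have hD0 : 0 ≤ D := by positivity
  -- The estimator error counts twice: `K` is the deviation at net points and `2 Λ d` the two
  -- passages to and from the net. The bias `D h` becomes `2 D / s` because `h ≤ 2 / s`. In the
  -- probability, `A * b` comes from the net and `b` from the event that no particle is near `θ₀`.
  refine ⟨2 * (K + 2 * (Λ * d)) + 2 * D, A * b + b, min a (a * v ^ 2), by positivity, by positivity,
    lt_min ha (by positivity), fun N hN => ?_⟩
  have hN1 : (1 : ℝ) ≤ N := by exact_mod_cast hN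
  have hN0 : (0 : ℝ) < N := by linarith
  have hd1 : (0 : ℝ) < (d : ℝ) + 1 := by positivity
  -- everything is expressed in `s = N ^ (1 / (2 (d + 1)))` and `w = s ^ ε`
  set s : ℝ := (N : ℝ) ^ (1 / (2 * ((d : ℝ) + 1))) with hs
  have hs1 : 1 ≤ s := Real.one_le_rpow hN1 (by positivity)
  have hs0 : 0 < s := by linarith
  have hsN : s ^ (2 * (d + 1)) = N := by
    rw [hs, ← Real.rpow_natCast, ← Real.rpow_mul hN0.le]
    push_cast
    rw [one_div_mul_cancel (by positivity), Real.rpow_one]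
  set w : ℝ := s ^ ε with hw
  have hw1 : 1 ≤ w := Real.one_le_rpow hs1 hε0.le
  have hws : w ≤ s := by
    simpa using Real.rpow_le_rpow_of_exponent_le hs1 hε1.le
  have hw0 : 0 < w := by linarith
  have hrate : (N : ℝ) ^ ((1 - ε) / (2 * ((d : ℝ) + 1))) = s / w := by
    rw [hw, hs, ← Real.rpow_mul hN0.le, ← Real.rpow_sub hN0]
    congr 1; ring
  have hw2 : (N : ℝ) ^ (ε / ((d : ℝ) + 1)) = w ^ 2 := by
    rw [hw, hs, ← Real.rpow_mul hN0.le, ← Real.rpow_natCast, ← Real.rpow_mul hN0.le]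
    congr 1; push_cast; field_simp
  rw [hrate, hw2]
  set h : ℝ := bandwidth d N with hh_def
  have hfl1 : (1 : ℝ) ≤ ⌊s⌋₊ := by exact_mod_cast (Nat.one_le_floor_iff _).2 hs1
  have hh : h = (⌊s⌋₊ : ℝ)⁻¹ := rfl
  have hh0 : 0 < h := by rw [hh]; positivity
  have hh1 : h ≤ 1 := by rw [hh]; exact inv_le_one_of_one_le₀ hfl1
  have hhs : h ≤ 2 / s := by
    rw [hh, inv_le_comm₀ (by linarith) (by positivity), inv_div]
    linarith [le_two_mul_natFloor hs1]
  have hhinv : h⁻¹ ≤ s := by rw [hh, inv_inv]; exact Nat.floor_le hs0.le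
  have hhpow : ∀ m : ℕ, (h ^ m)⁻¹ ≤ s ^ m := fun m => by
    rw [← inv_pow]; gcongr
  obtain ⟨Z, hZcard, hZ⟩ := hnet N hN
  -- Since `N = s ^ (2 (d + 1))`, this choice gives `N u² = w²`, while `u` times the kernel bound
  -- `h⁻ᵈ K` is at most `K w / s`.
  set u : ℝ := w / s ^ (d + 1) with hu
  have hu0 : 0 < u := by positivity
  have hNu : N * u ^ 2 = w ^ 2 := by
    rw [hu, div_pow, ← pow_mul, mul_comm (d + 1) 2, hsN]; field_simp
  set β : ℝ := (h ^ d)⁻¹ * K with hβ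
  have hβ0 : 0 < β := by positivity
  have hc : Continuous k := hk.continuous [] List.Pairwise.nil
  have hkm : ∀ z : EuclideanSpace ℝ (Fin d), Measurable fun y : Θ => scaledKernel k h (z - y) := by
    intro z
    refine Continuous.measurable ?_
    unfold scaledKernel
    fun_prop
  set bad : EuclideanSpace ℝ (Fin d) → Set Ω := fun z => {ω | u * β ≤
    |(N : ℝ)⁻¹ * ∑ i, scaledKernel k h (z - X N i ω) - ∫ y, scaledKernel k h (z - y) ∂π|} with hbad
  have hbadP : ∀ z, P.real (bad z) ≤ b * Real.exp (-(a * w ^ 2)) := fun z => by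
    rw [← hNu]
    refine hconc N hN (fun y => scaledKernel k h (z - y)) (hkm z) β hβ0 (fun y => ?_) u hu0.le
    rw [abs_of_nonneg (hk.scaledKernel_nonneg hh0 _)]
    exact scaledKernel_le hK hh0 _
  set φ : Θ → ℝ := fun y => (Metric.ball (θ₀ : EuclideanSpace ℝ (Fin d)) (r * h)).indicator
    (fun _ => (1 : ℝ)) (y : EuclideanSpace ℝ (Fin d)) with hφ
  have hφm : Measurable φ :=
    (measurable_const.indicator Metric.isOpen_ball.measurableSet).comp measurable_subtype_coe
  have hrh : 0 < r * h := by positivity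
  have hφlow : v * h ^ d ≤ ∫ y, φ y ∂π := by
    rw [hπ]
    refine le_trans (le_of_eq ?_) (integral_indicator_ball_ge hΘm hq hqlow hrh
      ((Metric.ball_subset_ball (by nlinarith)).trans hball))
    rw [hv, mul_pow]; ring
  have hvh : 0 < v * h ^ d := by positivity
  -- If no particle hits the ball, the empirical average of `φ` is `0` and deviates by the full mass
  -- of the ball. That mass is at least `v hᵈ`, and `N (v hᵈ)² ≥ v² s² ≥ v² w²`.
  set miss : Set Ω := {ω | (∫ y, φ y ∂π) * 1 ≤ |(N : ℝ)⁻¹ * ∑ i, φ (X N i ω) - ∫ y, φ y ∂π|}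
    with hmiss
  have hmissP : P.real miss ≤ b * Real.exp (-(a * v ^ 2 * w ^ 2)) := by
    refine (hconc N hN φ hφm 1 one_pos (fun y => ?_) _ (hvh.le.trans hφlow)).trans ?_
    · exact (norm_indicator_le_norm_self (fun _ => (1 : ℝ)) _).trans norm_one.le
    · refine mul_le_mul_of_nonneg_left (Real.exp_le_exp.2 (neg_le_neg ?_)) hb
      rw [mul_assoc]
      refine mul_le_mul_of_nonneg_left ?_ ha.le
      have h1 : (v * h ^ d) ^ 2 ≤ (∫ y, φ y ∂π) ^ 2 := by gcongr
      have h2 : w ^ 2 ≤ N * (h ^ d) ^ 2 := by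
        have h3 : 1 ≤ s ^ d * h ^ d := by
          have := hhpow d
          rwa [inv_le_iff_one_le_mul₀ (by positivity)] at this
        have h4 : (1 : ℝ) ≤ (s ^ d * h ^ d) ^ 2 := one_le_pow₀ h3
        calc w ^ 2 ≤ s ^ 2 := by gcongr
          _ = s ^ 2 * 1 := (mul_one _).symm
          _ ≤ s ^ 2 * (s ^ d * h ^ d) ^ 2 := by gcongr
          _ = N * (h ^ d) ^ 2 := by rw [← hsN]; ring
      calc v ^ 2 * w ^ 2 ≤ v ^ 2 * (N * (h ^ d) ^ 2) := by gcongr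
        _ = N * (v * h ^ d) ^ 2 := by ring
        _ ≤ _ := by gcongr
  -- Outside the exceptional events the argument is deterministic.
  have hsub : {ω | (2 * (K + 2 * (Λ * d)) + 2 * D) / (s / w) < q θ₀ - q (est N ω)} ⊆
      ((⋃ z ∈ Z, bad z) ∪ miss) ∪ {ω | ¬ ∃ i, est N ω = X N i ω ∧
      ∀ j, kde k (fun l => X N l ω) (X N j ω) ≤ kde k (fun l => X N l ω) (X N i ω)} := by
    intro ω hω
    by_contra hcon
    rw [Set.mem_union, not_or] at hcon
    obtain ⟨hcon, hcon'⟩ := hcon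
    obtain ⟨i, hi, hmax⟩ := not_not.1 hcon'
    simp only [Set.mem_union, Set.mem_iUnion, not_or, not_exists, Set.mem_ofPred_eq,
      not_le, hbad, hmiss, mul_one] at hcon
    obtain ⟨hgood, hhit⟩ := hcon
    obtain ⟨i₀, hi₀⟩ : ∃ i₀, ‖(X N i₀ ω : EuclideanSpace ℝ (Fin d)) - θ₀‖ < r * h := by
      by_contra hno
      have hzero : ∀ i, φ (X N i ω) = 0 := fun i => by
        refine Set.indicator_of_notMem (fun hmem => hno ⟨i, ?_⟩) _
        rwa [Metric.mem_ball, dist_eq_norm] at hmem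
      simp only [hzero, Finset.sum_const_zero, mul_zero, zero_sub, abs_neg] at hhit
      exact absurd (le_abs_self _) (not_le.2 hhit)
    have hη : ∀ θ : Θ, |kde k (fun l => X N l ω) θ
        - ∫ y : Θ, q y * scaledKernel k h (θ - y) ∂(lebesgueOn Θ)| ≤ (K + 2 * (Λ * d)) * (w / s) := by
      intro θ
      obtain ⟨z, hzZ, hz⟩ := hZ θ θ.2
      have h1 := abs_average_scaledKernel_sub_le hN hh0 hΛ (fun l => X N l ω) θ z
      have h2 := abs_integral_mul_scaledKernel_sub_le hk hh0 hq hq0 hq1 hΛ θ z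
      have h3 := (hgood z hzZ).le
      rw [hπ] at h3
      have h4 : (h ^ (d + 1))⁻¹ * Λ * ‖(θ : EuclideanSpace ℝ (Fin d)) - z‖ ≤ Λ * d * (w / s) := by
        calc (h ^ (d + 1))⁻¹ * Λ * ‖(θ : EuclideanSpace ℝ (Fin d)) - z‖
            ≤ s ^ (d + 1) * Λ * (d / N) := by
              gcongr
              exact hhpow _
          _ = Λ * d * (1 / s ^ (d + 1)) := by
              rw [← hsN]; field_simp; ring
          _ ≤ Λ * d * (w / s) := by
              gcongr
              exact le_self_pow₀ hs1 (by omega)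
      have h5 : u * β ≤ K * (w / s) := by
        calc u * β ≤ u * (s ^ d * K) := by
              rw [hβ]; gcongr; exact hhpow d
          _ = K * (w / s) := by rw [hu]; field_simp; ring
      have h6 := abs_sub_le (kde k (fun l => X N l ω) θ)
        ((N : ℝ)⁻¹ * ∑ i, scaledKernel k h (z - X N i ω))
        (∫ y : Θ, q y * scaledKernel k h (θ - y) ∂(lebesgueOn Θ))
      have h7 := abs_sub_le ((N : ℝ)⁻¹ * ∑ i, scaledKernel k h (z - X N i ω))
        (∫ y : Θ, q y * scaledKernel k h (z - y) ∂(lebesgueOn Θ))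
        (∫ y : Θ, q y * scaledKernel k h (θ - y) ∂(lebesgueOn Θ))
      rw [abs_sub_comm] at h2
      have h8 : |kde k (fun l => X N l ω) θ - (N : ℝ)⁻¹ * ∑ i, scaledKernel k h (z - X N i ω)|
        ≤ (h ^ (d + 1))⁻¹ * Λ * ‖(θ : EuclideanSpace ℝ (Fin d)) - z‖ := h1
      linarith
    have hgap := density_gap_le (x := fun l => X N l ω) (p := kde k fun l => X N l ω)
      (i₀ := i₀) (i := i) hΘm hk hq hq0 hQ hL hh0 hh1 hr hball hη hi₀ (hmax i₀)
    have hω' : (2 * (K + 2 * (Λ * d)) + 2 * D) / (s / w) < q θ₀ - q (est N ω) := hω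
    rw [hi, div_div_eq_mul_div] at hω'
    have h9 : D * h ≤ 2 * D * (w / s) := by
      calc D * h ≤ D * (2 / s) := by gcongr
        _ ≤ D * (2 * w / s) := by gcongr; linarith
        _ = _ := by ring
    have h10 : (2 * (K + 2 * (Λ * d)) + 2 * D) * w / s
      = 2 * ((K + 2 * (Λ * d)) * (w / s)) + 2 * D * (w / s) := by ring
    linarith
  have hnull : P.real {ω | ¬ ∃ i, est N ω = X N i ω ∧
      ∀ j, kde k (fun l => X N l ω) (X N j ω) ≤ kde k (fun l => X N l ω) (X N i ω)} = 0 := by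
    rw [measureReal_def, ae_iff.1 (hest N hN), ENNReal.toReal_zero]
  have e1 := exp_tail_mono (a := a) (a' := min a (a * v ^ 2)) (min_le_left _ _) hb (sq_nonneg w)
  have e2 := exp_tail_mono (a := a * v ^ 2) (a' := min a (a * v ^ 2)) (min_le_right _ _) hb
    (sq_nonneg w)
  set Ex := Real.exp (-(min a (a * v ^ 2) * w ^ 2)) with hEx
  have hEx0 : 0 < Ex := Real.exp_pos _
  have hU : P.real (⋃ z ∈ Z, bad z) ≤ A * (N : ℝ) ^ d * (b * Ex) := by
    refine (measureReal_biUnion_finset_le Z bad).trans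
      ((Finset.sum_le_sum fun z _ => (hbadP z).trans e1).trans ?_)
    rw [Finset.sum_const, nsmul_eq_mul]
    gcongr
  have hNd : (1 : ℝ) ≤ (N : ℝ) ^ d := one_le_pow₀ hN1
  calc _ ≤ _ := measureReal_mono hsub
    _ ≤ _ := (measureReal_union_le _ _).trans (add_le_add_left (measureReal_union_le _ _) _)
    _ ≤ A * (N : ℝ) ^ d * (b * Ex) + b * Ex + 0 :=
        add_le_add (add_le_add hU (hmissP.trans e2)) hnull.le
    _ ≤ A * (N : ℝ) ^ d * (b * Ex) + (N : ℝ) ^ d * (b * Ex) := by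
        have := le_mul_of_one_le_left (mul_nonneg hb hEx0.le) hNd
        linarith
    _ = _ := by ring

end gap

/-! ### From summable tails to an integrable almost sure rate -/

/-- By `exp x ≥ x ^ m / m!` with `γ m ≥ p + 2`, the terms are dominated by a multiple of `N ^ (-2)`.
-/
theorem summable_rpow_mul_exp_neg_rpow {p a γ : ℝ} (ha : 0 < a) (hγ : 0 < γ) :
    Summable fun N : ℕ => (N : ℝ) ^ p * Real.exp (-(a * (N : ℝ) ^ γ)) := by
  obtain ⟨m, hm⟩ := exists_nat_ge ((p + 2) / γ)
  have hm' : p + 2 ≤ γ * m := by rwa [div_le_iff₀' hγ] at hm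
  have hs : Summable fun N : ℕ => ((m.factorial : ℝ) / a ^ m) * (N : ℝ) ^ (-2 : ℝ) :=
    (Real.summable_nat_rpow.2 (by norm_num)).mul_left _
  refine Summable.of_norm_bounded_eventually_nat hs ?_
  filter_upwards [Filter.eventually_ge_atTop 1] with N hN
  have hN1 : (1 : ℝ) ≤ N := by exact_mod_cast hN
  have hN0 : (0 : ℝ) < N := by linarith
  rw [Real.norm_eq_abs, abs_of_nonneg (by positivity), Real.exp_neg]
  have h1 := Real.pow_div_factorial_le_exp (a * (N : ℝ) ^ γ) (by positivity) m
  have hfac : (0 : ℝ) < m.factorial := by positivity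
  have h2 : (Real.exp (a * (N : ℝ) ^ γ))⁻¹ ≤ ((a * (N : ℝ) ^ γ) ^ m / m.factorial)⁻¹ := by
    gcongr
  calc (N : ℝ) ^ p * (Real.exp (a * (N : ℝ) ^ γ))⁻¹
      ≤ (N : ℝ) ^ p * ((a * (N : ℝ) ^ γ) ^ m / m.factorial)⁻¹ := by gcongr
    _ = ((m.factorial : ℝ) / a ^ m) * ((N : ℝ) ^ p / (N : ℝ) ^ (γ * m)) := by
        rw [mul_pow, ← Real.rpow_natCast ((N : ℝ) ^ γ) m, ← Real.rpow_mul hN0.le, inv_div]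
        field_simp
    _ ≤ ((m.factorial : ℝ) / a ^ m) * (N : ℝ) ^ (-2 : ℝ) := by
        rw [← Real.rpow_sub hN0]
        gcongr
        linarith

/-- Bounded errors whose tails beyond the rate `1 / ρ N` are summable are almost surely of
order `1 / ρ N`, uniformly in `N` and with an integrable constant. -/
theorem exists_integrable_rate {Ω : Type*} [MeasurableSpace Ω] {P : Measure Ω}
    [IsProbabilityMeasure P] {D : ℕ → Ω → ℝ} (hD : ∀ N, 1 ≤ N → Measurable (D N)) {M : ℝ}
    (hDM : ∀ N ω, D N ω ≤ M) {ρ : ℕ → ℝ} (hρ : ∀ N, 1 ≤ N → 0 < ρ N) {C : ℝ} (hC : 0 ≤ C)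
    {p : ℕ → ℝ} (hp : ∀ N, 1 ≤ N → P.real {ω | C / ρ N < D N ω} ≤ p N)
    (hsum : Summable fun N => ρ N * p N) :
    ∃ W : Ω → ℝ, Integrable W P ∧ ∀ᵐ ω ∂P, ∀ N, 1 ≤ N → D N ω ≤ W ω / ρ N := by
  classical
  -- The indices are shifted by one, because nothing is assumed about `D 0` and `ρ 0` beyond the
  -- upper bound on `D 0`.
  set A : ℕ → Set Ω := fun N => {ω | C / ρ (N + 1) < D (N + 1) ω} with hA
  have hAm : ∀ N, MeasurableSet (A N) := fun N =>
    measurableSet_lt measurable_const (hD (N + 1) (by omega))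
  -- Each failure event contributes `|M| ρ`, just enough for `F / ρ` to exceed the trivial bound `M`
  -- there. By Tonelli the expectation of `F` is the weighted sum of the failure probabilities.
  set F : Ω → ENNReal := fun ω => ∑' N, (A N).indicator
    (fun _ => ENNReal.ofReal (|M| * ρ (N + 1))) ω with hF
  have hFm : Measurable F := Measurable.tsum fun N => measurable_const.indicator (hAm N)
  have hFint : ∫⁻ ω, F ω ∂P ≠ ⊤ := by
    rw [hF, lintegral_tsum fun N => (measurable_const.indicator (hAm N)).aemeasurable]
    have hs : Summable fun N => |M| * (ρ (N + 1) * p (N + 1)) :=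
      ((summable_nat_add_iff 1).2 hsum).mul_left _
    refine ne_top_of_le_ne_top hs.tsum_ofReal_ne_top (ENNReal.tsum_le_tsum fun N => ?_)
    have h1 := hρ (N + 1) (by omega)
    rw [lintegral_indicator_const (hAm N), ← ofReal_measureReal (μ := P) (s := A N),
      ← ENNReal.ofReal_mul (by positivity), ← mul_assoc]
    refine ENNReal.ofReal_le_ofReal (mul_le_mul_of_nonneg_left (hp (N + 1) (by omega)) ?_)
    positivity
  refine ⟨fun ω => C + (F ω).toReal,
    (integrable_const C).add (integrable_toReal_of_lintegral_ne_top hFm.aemeasurable hFint), ?_⟩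
  filter_upwards [ae_lt_top hFm hFint] with ω hω N hN
  obtain ⟨N, rfl⟩ : ∃ N', N = N' + 1 := ⟨N - 1, by omega⟩
  have hρN := hρ (N + 1) hN
  rw [le_div_iff₀ hρN]
  by_cases hmem : ω ∈ A N
  · have h1 : ENNReal.ofReal (|M| * ρ (N + 1)) ≤ F ω := by
      refine le_trans ?_ (ENNReal.le_tsum N)
      rw [Set.indicator_of_mem hmem]
    have h2 := (ENNReal.ofReal_le_iff_le_toReal hω.ne).1 h1
    have h3 : D (N + 1) ω * ρ (N + 1) ≤ |M| * ρ (N + 1) :=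
      mul_le_mul_of_nonneg_right ((hDM _ _).trans (le_abs_self M)) hρN.le
    linarith
  · have h1 : D (N + 1) ω ≤ C / ρ (N + 1) := not_lt.1 hmem
    rw [le_div_iff₀ hρN] at h1
    have : 0 ≤ (F ω).toReal := ENNReal.toReal_nonneg
    linarith

theorem lebesgueOn_ne_zero {d : ℕ} {Θ : Set (EuclideanSpace ℝ (Fin d))}
    (hΘ : MeasurableSet Θ) (hint : (interior Θ).Nonempty) : lebesgueOn Θ ≠ 0 := by
  intro h0
  have h1 : lebesgueOn Θ Set.univ = volume Θ := by
    rw [lebesgueOn, comap_subtype_coe_apply hΘ]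
    simp
  rw [h0] at h1
  exact (Measure.measure_pos_of_nonempty_interior volume hint).ne h1

/-! ### The main theorem -/

theorem mainTheorem6 {d n : ℕ}
    -- the compact search space, the component functions, and the mini-batches
    (Θ : Set (EuclideanSpace ℝ (Fin d))) (hΘ : IsCompact Θ)
    (f : Fin n → Θ → ℝ) (hf : ∀ i, Measurable (f i))
    (T : ℕ) (I : ℕ → Finset (Fin n))
    (hI_disj : ∀ s ≤ T, ∀ t ≤ T, s ≠ t → Disjoint (I s) (I t))
    (hI_cover : ∀ i, ∃ t ≤ T, i ∈ I t)
    -- the prior is well defined, the potentials and the cost are bounded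
    (hprior : Integrable (potential f (I 0)) (lebesgueOn Θ))
    (hG : ∀ t, 1 ≤ t → t ≤ T → ∃ B : ℝ, ∀ θ, potential f (I t) θ ≤ B)
    (hf_bdd : ∃ B : ℝ, ∀ θ, |totalCost f θ| ≤ B)
    -- the target density is Lipschitz; some minimizer is interior
    (hLip : ∃ L : NNReal, LipschitzWith L (targetDensity (lebesgueOn Θ) f I T))
    (hint : ∃ θ₀ : Θ, (∀ θ, totalCost f θ₀ ≤ totalCost f θ) ∧
      (θ₀ : EuclideanSpace ℝ (Fin d)) ∈ interior Θ)
    -- the smoothing kernel and the jittering kernels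
    (k : EuclideanSpace ℝ (Fin d) → ℝ) (hk : IsSmoothingKernel k)
    (κ : ℕ → Kernel Θ Θ) [∀ N, IsMarkovKernel (κ N)] (hκ : IsJittering κ)
    -- runs of the sampler with every number of particles, on a common probability space
    {Ω : Type*} [MeasurableSpace Ω] (P : Measure Ω) [IsProbabilityMeasure P]
    (X Y : (N : ℕ) → ℕ → Fin N → Ω → Θ)
    (hX : ∀ N, 1 ≤ N →
      IsSampler P (prior (lebesgueOn Θ) f I) (κ N) (fun t => potential f (I t)) T N (X N) (Y N))
    -- a global minimizer and the estimators
    (θs : Θ) (hθs : ∀ θ, totalCost f θs ≤ totalCost f θ)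
    (est : ℕ → Ω → Θ) (hest_meas : ∀ N, 1 ≤ N → Measurable (est N))
    (hest : ∀ N, 1 ≤ N → ∀ᵐ ω ∂P, ∃ i, est N ω = X N T i ω ∧
      ∀ j, kde k (fun l => X N T l ω) (X N T j ω) ≤ kde k (fun l => X N T l ω) (X N T i ω))
    (ε : ℝ) (hε0 : 0 < ε) (hε1 : ε < 1) :
    ∃ W : Ω → ℝ, Integrable W P ∧
      (∀ᵐ ω ∂P, ∀ N : ℕ, 1 ≤ N →
        0 ≤ totalCost f (est N ω) - totalCost f θs ∧
        totalCost f (est N ω) - totalCost f θs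
          ≤ W ω / (N : ℝ) ^ ((1 - ε) / (2 * ((d : ℝ) + 1)))) ∧
      ∀ N : ℕ, 1 ≤ N →
        Integrable (fun ω => totalCost f (est N ω)) P ∧
        0 ≤ (∫ ω, totalCost f (est N ω) ∂P) - totalCost f θs ∧
        (∫ ω, totalCost f (est N ω) ∂P) - totalCost f θs
          ≤ (∫ ω, W ω ∂P) / (N : ℝ) ^ ((1 - ε) / (2 * ((d : ℝ) + 1))) := by
  have hΘm := hΘ.measurableSet
  obtain ⟨θ₀, hθ₀, hθ₀int⟩ := hint
  have hμ := lebesgueOn_ne_zero hΘm ⟨_, hθ₀int⟩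
  obtain ⟨F, hF⟩ := hf_bdd
  obtain ⟨L, hL⟩ := hLip
  have hfm : Measurable (totalCost f) := Finset.measurable_sum _ fun i _ => hf i
  obtain ⟨-, hpos, hqint, hq1, c, hc, hform⟩ := targetDensity_spec hμ hf hprior hG T le_rfl
  have hqm := (targetDensity_spec hμ hf hprior hG T le_rfl).1
  have hq : ∀ θ, targetDensity (lebesgueOn Θ) f I T θ = c * Real.exp (-totalCost f θ) := fun θ => by
    rw [hform, prod_potential_eq f hI_disj hI_cover]
  have hlow : ∀ θ, c * Real.exp (-F) ≤ targetDensity (lebesgueOn Θ) f I T θ := fun θ => by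
    have := (abs_le.1 (hF θ)).2
    rw [hq]; gcongr
  have hup : ∀ θ, targetDensity (lebesgueOn Θ) f I T θ ≤ c * Real.exp F := fun θ => by
    have := (abs_le.1 (hF θ)).1
    rw [hq]; gcongr; linarith
  set q₀ := c * Real.exp (-F) with hq₀
  have hq₀pos : 0 < q₀ := by positivity
  obtain ⟨C, C₁, a, hC, hC₁, ha, htail⟩ := exists_density_gap_tail hΘ hk hqint hq1 hq₀pos hlow hup hL
    (integral_targetMeasure hqm hpos)
    (expConcentrates_targetMeasure hμ hf hprior hG hκ hX) hθ₀int hest hε0 hε1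
  -- The chosen minimizer `θs` may lie on the boundary; only the common minimal value matters, so
  -- the interior minimizer `θ₀` can replace it.
  have hmin : totalCost f θs = totalCost f θ₀ := le_antisymm (hθs _) (hθ₀ _)
  -- With `x` the excess cost of `θ`, the density gap is `q θ * (exp x - 1) ≥ q₀ * x`.
  have hgap : ∀ θ, totalCost f θ - totalCost f θs ≤ (targetDensity (lebesgueOn Θ) f I T θ₀
      - targetDensity (lebesgueOn Θ) f I T θ) / q₀ := fun θ => by
    have h1 := Real.add_one_le_exp (totalCost f θ - totalCost f θ₀)
    have h2 : targetDensity (lebesgueOn Θ) f I T θ₀ = targetDensity (lebesgueOn Θ) f I T θ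
        * Real.exp (totalCost f θ - totalCost f θ₀) := by
      rw [hq, hq, mul_assoc, ← Real.exp_add]; congr 2; ring
    rw [hmin, le_div_iff₀ hq₀pos, h2]
    have h3 := sub_nonneg.2 (hθ₀ θ)
    calc (totalCost f θ - totalCost f θ₀) * q₀
        ≤ (totalCost f θ - totalCost f θ₀) * targetDensity (lebesgueOn Θ) f I T θ :=
          mul_le_mul_of_nonneg_left (hlow θ) h3
      _ ≤ (Real.exp (totalCost f θ - totalCost f θ₀) - 1)
          * targetDensity (lebesgueOn Θ) f I T θ :=
          mul_le_mul_of_nonneg_right (by linarith) (hpos θ).le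
      _ = _ := by ring
  set β : ℝ := (1 - ε) / (2 * ((d : ℝ) + 1)) with hβ
  have hd1 : (0 : ℝ) < (d : ℝ) + 1 := by positivity
  -- The stretched exponential beats both the rate `N ^ β` and the net cardinality `N ^ d`.
  have hsum : Summable fun N : ℕ => (N : ℝ) ^ β * (C₁ * (N : ℝ) ^ d
      * Real.exp (-(a * (N : ℝ) ^ (ε / ((d : ℝ) + 1))))) := by
    have h1 := (summable_rpow_mul_exp_neg_rpow (p := β + d) ha
      (div_pos hε0 hd1)).mul_left C₁
    refine h1.congr fun N => ?_
    have hβ0 : 0 < β := div_pos (by linarith) (by positivity)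
    rw [Real.rpow_add_of_nonneg (Nat.cast_nonneg N) hβ0.le (Nat.cast_nonneg d),
      Real.rpow_natCast]
    ring
  obtain ⟨W, hWint, hW⟩ := exists_integrable_rate (P := P)
    (D := fun N ω => totalCost f (est N ω) - totalCost f θs)
    (fun N hN => (hfm.comp (hest_meas N hN)).sub_const _) (M := 2 * F)
    (fun N ω => by
      have h1 := (abs_le.1 (hF (est N ω))).2
      have h2 := (abs_le.1 (hF θs)).1
      linarith)
    (ρ := fun N => (N : ℝ) ^ β) (fun N hN => Real.rpow_pos_of_pos (by exact_mod_cast hN) _)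
    (C := C / q₀) (by positivity)
    (fun N hN => (measureReal_mono fun ω (hω : C / q₀ / (N : ℝ) ^ β < _) => by
      have h1 := hω.trans_le (hgap (est N ω))
      rw [div_right_comm, div_lt_div_iff_of_pos_right hq₀pos] at h1
      exact h1).trans (htail N hN)) hsum
  refine ⟨W, hWint, ?_, fun N hN => ?_⟩
  · filter_upwards [hW] with ω hω N hN
    exact ⟨sub_nonneg.2 (hθs _), hω N hN⟩
  · have hfint : Integrable (fun ω => totalCost f (est N ω)) P :=
      Integrable.of_bound (hfm.comp (hest_meas N hN)).aestronglyMeasurable F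
        (ae_of_all _ fun ω => hF _)
    have h1 : (∫ ω, totalCost f (est N ω) ∂P) - totalCost f θs
        = ∫ ω, (totalCost f (est N ω) - totalCost f θs) ∂P := by
      rw [integral_sub hfint (integrable_const _)]; simp
    rw [h1, ← integral_div]
    refine ⟨hfint, integral_nonneg fun ω => sub_nonneg.2 (hθs _), ?_⟩
    refine integral_mono_ae (hfint.sub (integrable_const _)) (hWint.div_const _) ?_
    filter_upwards [hW] with ω hω using hω N hN
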